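/- Let $n,N\in\mathbb N$, $\Omega\subset\mathbb R^n$ open, $T>0$, $\Omega_T=\Omega\times(0,T)$. Let $\Phi:\mathbb R^N\to\mathbb R$ be twice continuously differentiable with $$\lambda|\xi|^2\le \sum_{i,j}\Phi_{z_iz_j}(z)\,\xi^i\xi^j\le\Lambda|\xi|^2\qquad(z,\xi\in\mathbb R^N)$$ for constants $\lambda>0$ and $\Lambda$ (so $\Phi$ is strictly convex). Let $V(\Omega_T;\mathbb R^N)$ be the closure of the $C^1(\Omega_T;\mathbb R^N)$ functions of finite norm under $$\|v\|_{V}^2=\sup_{0<t<T}\int_\Omega|v(x,t)|^2\,dx+\iint_{\Omega_T}|\nabla v|^2\,dx\,dt ,$$ where $\nabla$ is the gradient in $x$. A weak solution of $u_t-\Delta[\nabla\Phi(u)]=0$ is a $u\in V(\Omega_T;\mathbb R^N)$ with $$\iint_{\Omega_T}\Big(-\sum_i u^iw^i_t+\sum_{i,\alpha}(\Phi_{z_i}(u))_{x_\alpha}w^i_{x_\alpha}\Big)\,dx\,dt=0\qquad\text{for all } w\in H^1_0(\Omega_T;\mathbb R^N),$$ where $(\Phi_{z_i}(u))_{x_\alpha}\in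 L^2(\Omega_T)$ is the weak derivative. For $f\in L^2(\Omega;\mathbb R^N)$ let $i(f)(\varphi)=\int_\Omega f\cdot\varphi\,dx$ and let $$\|i(f)\|_{H^{-1}(\Omega)}=\sup\Big\{|i(f)(\varphi)|:\ \varphi\in H^1_0(\Omega;\mathbb R^N),\ \int_\Omega|\nabla\varphi|^2\,dx\le1\Big\}\in[0,\infty],$$ the norm dual to $(\int_\Omega|\nabla\varphi|^2)^{1/2}$ (finite if $\Omega$ is bounded and $n\ge1$, and then equal to $(\int_\Omega|\nabla\Delta^{-1}f|^2\,dx)^{1/2}$ with the Dirichlet Laplacian $\Delta$). Theorem (Uniqueness). Let $u_0,u_1\in V(\Omega_T;\mathbb R^N)$ be two weak solutions of $u_t-\Delta[\nabla\Phi(u)]=0$ with the same boundary values, that is, $u_0(\cdot,t)-u_1(\cdot,t)\in H^1_0(\Omega;\mathbb R^N)$ for almost all $t\in[0,T]$. Then: 1. For each $k\in\{0,1\}$, $t\mapsto u_k(\cdot,t)$ is weakly continuous from $(0,T)$ to $L^2(\Omega;\mathbb R^N)$ and has weak limits in $L^2(\Omega;\mathbb R^N)$ as $t\to0$ and as $t\to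 T$, denoted $u_k(0)$ and $u_k(T)$; so $u_k(t)$ is defined for every $t\in[0,T]$. 2. For all $0\le t_0\le t_1\le T$, $$\|i(u_0(t_1)-u_1(t_1))\|_{H^{-1}(\Omega)}\le e^{\lambda(t_1-t_0)}\,\|i(u_0(t_0)-u_1(t_0))\|_{H^{-1}(\Omega)} .$$ 3. If $u_0(0)=u_1(0)$, then $u_0(\cdot,t)=u_1(\cdot,t)$ almost everywhere in $\Omega$ for every $t\in(0,T)$. -/

import Mathlib

open MeasureTheory Set Filter Topology
open scoped ENNReal ContDiff

noncomputable section

namespace DiffusionSystem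

/-- The space of positions (dimension `n`), or of values of the unknown (dimension `N`). -/
abbrev Euc (n : ℕ) : Type := EuclideanSpace ℝ (Fin n)

/-- The coordinate vector `e_α`. -/
def basisVec {n : ℕ} (α : Fin n) : Euc n := EuclideanSpace.single α (1 : ℝ)

/-- The parabolic cylinder `Ω_T = Ω × (0, T)`. -/
def cyl {n : ℕ} (Ω : Set (Euc n)) (T : ℝ) : Set (Euc n × ℝ) := Ω ×ˢ Ioo 0 T

/-- `φ ∈ C_c^∞(U; F)`. -/
def IsTestFun {E F : Type*} [NormedAddCommGroup E] [NormedSpace ℝ E]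
    [NormedAddCommGroup F] [NormedSpace ℝ F] (U : Set E) (φ : E → F) : Prop :=
  ContDiff ℝ ∞ φ ∧ HasCompactSupport φ ∧ tsupport φ ⊆ U

/-- `f ∈ H^1_0(U; F)` with gradient `G`: the pair `(f, G)` is the limit in `L²(U)` of
`(φ_k, Dφ_k)` for a sequence `φ_k` of test functions on `U`. -/
def IsH10 {E F : Type*} [NormedAddCommGroup E] [NormedSpace ℝ E] [MeasureSpace E]
    [NormedAddCommGroup F] [NormedSpace ℝ F]
    (U : Set E) (f : E → F) (G : E → E →L[ℝ] F) : Prop :=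
  MemLp f 2 (volume.restrict U) ∧ MemLp G 2 (volume.restrict U) ∧
    ∃ φ : ℕ → E → F, (∀ k, IsTestFun U (φ k)) ∧
      Tendsto (fun k => eLpNorm (fun x => f x - φ k x) 2 (volume.restrict U)) atTop (𝓝 0) ∧
      Tendsto (fun k => eLpNorm (fun x => G x - fderiv ℝ (φ k) x) 2 (volume.restrict U))
        atTop (𝓝 0)

/-- The classical spatial derivative `∂φ/∂x_α` of a function of `(x, t)`. -/
def spaceDeriv {n : ℕ} {F : Type*} [NormedAddCommGroup F] [NormedSpace ℝ F]
    (α : Fin n) (φ : Euc n × ℝ → F) (p : Euc n × ℝ) : F :=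
  fderiv ℝ φ p (basisVec α, 0)

/-- `g` is the weak derivative `∂v/∂x_α` of `v` in `Ω_T`. -/
def HasWeakSpaceDeriv {n N : ℕ} (Ω : Set (Euc n)) (T : ℝ) (α : Fin n)
    (v g : Euc n × ℝ → Euc N) : Prop :=
  LocallyIntegrableOn v (cyl Ω T) ∧ LocallyIntegrableOn g (cyl Ω T) ∧
    ∀ φ : Euc n × ℝ → ℝ, IsTestFun (cyl Ω T) φ →
      ∫ p in cyl Ω T, spaceDeriv α φ p • v p = - ∫ p in cyl Ω T, φ p • g p

/-- The squared norm `sup_{0<t<T} ∫_Ω |v(x,t)|² dx + ∬_{Ω_T} |∇v|² dx dt`, where `Dv α` is the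
derivative of `v` in the direction `x_α`. The supremum is over every `t`, not almost every. -/
def vNormSq {n N : ℕ} (Ω : Set (Euc n)) (T : ℝ) (v : Euc n × ℝ → Euc N)
    (Dv : Fin n → Euc n × ℝ → Euc N) : ℝ≥0∞ :=
  (⨆ t ∈ Ioo (0 : ℝ) T, ∫⁻ x in Ω, ‖v (x, t)‖ₑ ^ 2) +
    ∫⁻ p in cyl Ω T, ∑ α, ‖Dv α p‖ₑ ^ 2

/-- `u ∈ V(Ω_T; ℝ^N)`: `u` is the limit, in the norm above, of functions that are `C^1` in `Ω_T`
and have finite norm. -/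
def MemV {n N : ℕ} (Ω : Set (Euc n)) (T : ℝ) (u : Euc n × ℝ → Euc N) : Prop :=
  AEStronglyMeasurable u (volume.restrict (cyl Ω T)) ∧
  (∀ t ∈ Ioo (0 : ℝ) T, AEStronglyMeasurable (fun x => u (x, t)) (volume.restrict Ω)) ∧
  ∃ Du : Fin n → Euc n × ℝ → Euc N,
    (∀ α, AEStronglyMeasurable (Du α) (volume.restrict (cyl Ω T))) ∧
    ∃ φ : ℕ → Euc n × ℝ → Euc N,
      (∀ k, ContDiffOn ℝ 1 (φ k) (cyl Ω T) ∧
        vNormSq Ω T (φ k) (fun α => spaceDeriv α (φ k)) < ⊤) ∧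
      Tendsto (fun k => vNormSq Ω T (fun p => u p - φ k p)
        (fun α p => Du α p - spaceDeriv α (φ k) p)) atTop (𝓝 0)

/-- `u` is a weak solution of `u_t - Δ[∇Φ(u)] = 0` in `Ω_T`: `u ∈ V(Ω_T; ℝ^N)` and
`∬ -u^i w^i_t + (Φ_{z_i}(u))_{x_α} w^i_{x_α} dx dt = 0` for all `w ∈ H^1_0(Ω_T; ℝ^N)`.
Here `W` is the space-time gradient of `w`, and `Dv α` is the weak derivative of `∇Φ(u)` in the
direction `x_α`. -/
def IsWeakSolution {n N : ℕ} (Φ : Euc N → ℝ) (Ω : Set (Euc n)) (T : ℝ)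
    (u : Euc n × ℝ → Euc N) : Prop :=
  MemV Ω T u ∧
  ∃ Dv : Fin n → Euc n × ℝ → Euc N,
    (∀ α, MemLp (Dv α) 2 (volume.restrict (cyl Ω T))) ∧
    (∀ α, HasWeakSpaceDeriv Ω T α (fun p => gradient Φ (u p)) (Dv α)) ∧
    ∀ (w : Euc n × ℝ → Euc N) (W : Euc n × ℝ → (Euc n × ℝ) →L[ℝ] Euc N),
      IsH10 (cyl Ω T) w W →
      ∫ p in cyl Ω T, (- inner ℝ (u p) (W p (0, 1)) +
        ∑ α, inner ℝ (Dv α p) (W p (basisVec α, 0))) = 0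

/-- Equal boundary values: for almost every `t ∈ [0, T]` the function `u₀(·,t) - u₁(·,t)` has zero
trace on `∂Ω`, i.e. lies in `H^1_0(Ω; ℝ^N)`. -/
def SameBoundaryValues {n N : ℕ} (Ω : Set (Euc n)) (T : ℝ) (u₀ u₁ : Euc n × ℝ → Euc N) : Prop :=
  ∀ᵐ t ∂(volume.restrict (Icc (0 : ℝ) T)),
    ∃ G : Euc n → Euc n →L[ℝ] Euc N, IsH10 Ω (fun x => u₀ (x, t) - u₁ (x, t)) G

/-- `g ∈ L²(Ω; ℝ^N)` is the value of `u` at the time `t ∈ [0, T]`: `u(·,s)` converges to `g` weakly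
in `L²(Ω)` as `s → t`, `s ∈ (0, T)`. For `0 < t < T` the point `s = t` is not excluded from the
limit, so that `g` can only be `u(·,t)`. -/
def IsTimeValue {n N : ℕ} (Ω : Set (Euc n)) (T : ℝ) (u : Euc n × ℝ → Euc N) (t : ℝ)
    (g : Euc n → Euc N) : Prop :=
  MemLp g 2 (volume.restrict Ω) ∧
  ∀ h : Euc n → Euc N, MemLp h 2 (volume.restrict Ω) →
    Tendsto (fun s => ∫ x in Ω, inner ℝ (u (x, s)) (h x)) (𝓝[Ioo 0 T] t)
      (𝓝 (∫ x in Ω, inner ℝ (g x) (h x)))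

/-- The natural embedding `i` of `L²(Ω)` into `H^{-1}(Ω)`: `i(f)(φ) = ∫_Ω f·φ dx`. -/
def embed {n N : ℕ} (Ω : Set (Euc n)) (f φ : Euc n → Euc N) : ℝ :=
  ∫ x in Ω, inner ℝ (f x) (φ x)

/-- The norm of `i(f)` in `H^{-1}(Ω; ℝ^N)`, the dual of `H^1_0(Ω; ℝ^N)` with the norm
`(∫_Ω |∇φ|² dx)^{1/2}`, `|∇φ|² = ∑_α |φ_{x_α}|²`. It equals `(∫_Ω |∇(Δ⁻¹ f)|² dx)^{1/2}`, where
`Δ⁻¹` is the inverse of the Dirichlet Laplacian, whenever `Δ⁻¹ f` exists. It is finite for every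
`f ∈ L²(Ω)` if `Ω` is bounded and `n ≥ 1`; in general it may be `∞`. -/
def hNegOneNorm {n N : ℕ} (Ω : Set (Euc n)) (f : Euc n → Euc N) : ℝ≥0∞ :=
  ⨆ (φ : Euc n → Euc N) (G : Euc n → Euc n →L[ℝ] Euc N) (_ : IsH10 Ω φ G)
    (_ : ∫⁻ x in Ω, ∑ α, ‖G x (basisVec α)‖ₑ ^ 2 ≤ 1), ‖embed Ω f φ‖ₑ

end DiffusionSystem

end

set_option linter.unusedSectionVars false

/-! Write `P` for the gradient of `Φ`. Formally the equation is a gradient flow for the `H⁻¹` inner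
product: pairing the equation for `u₀ - u₁` with `-Δ⁻¹(u₀ - u₁)` gives half the time derivative of
the squared `H⁻¹` norm as `-∫ (u₀ - u₁)·(P(u₀) - P(u₁))`, which is nonpositive because a nonnegative
Hessian makes `P` monotone. So the `H⁻¹` distance does not increase. This is a contraction with
constant 1, and the stated factor `exp (lam * (t₁ - t₀))` is at least 1.

As `Ω` is an arbitrary open set, `Δ⁻¹` is replaced by a vector field. If the `H⁻¹` norm at time `s`
is finite, Hahn–Banach and Riesz give an `L²` field `D` with `-div D = u₀(s) - u₁(s)` and norm at
most that `H⁻¹` norm (`exists_isDiv`). With `q = ∇P(u₀) - ∇P(u₁)`, the field `D(t) = D - ∫ q`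
(integral over `[s, t]`) satisfies `-div D(t) = u₀(t) - u₁(t)` by the equation
(`SolData.isDiv_sub`). It need not be a gradient: any field representing the difference bounds its
`H⁻¹` norm from above (`IsDiv.hNegOneNorm_le`), so it suffices that the `L²` norm of `D(t)` does not
increase (`toReal_eLpNorm_sub_primitive_le`).

The dissipation is `∫ D(t)·q(t)`. It equals `∫ (u₀ - u₁)·(P(u₀) - P(u₁))` provided that `P(u₀) -
P(u₁)` may be used as a test function for the divergence. This is where the boundary condition
enters, for almost every `t` (`IsDiv.integral_inner_comp_sub`), together with the chain rule for
`P(u)` (`VApprox.weakDeriv_comp`).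

Values at every time come from two facts. The supremum over `t` in the norm of `V` makes its
elements weakly continuous in time. Testing the equation with `η(t) φ(x)` shows that `∫ u·φ` is a
primitive of an integrable function, so it has limits at `0` and `T`; boundedness in `L²` and
density of test functions turn these into weak limits. -/

namespace DiffusionSystem

/-! ### Hilbert space lemmas -/

section Hilbert

variable {H : Type*} [NormedAddCommGroup H] [InnerProductSpace ℝ H]

/-- A linear functional that is dominated by `C ‖j v‖` is represented by a vector of norm at most
`C`. -/
theorem exists_inner_eq_of_le [CompleteSpace H] {V : Type*} [AddCommGroup V] [Module ℝ V]
    (j : V →ₗ[ℝ] H) (l : V →ₗ[ℝ] ℝ) {C : ℝ} (hC : 0 ≤ C) (h : ∀ v, |l v| ≤ C * ‖j v‖) :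
    ∃ g : H, ‖g‖ ≤ C ∧ ∀ v, l v = inner ℝ g (j v) := by
  have hker : LinearMap.ker j ≤ LinearMap.ker l := by
    intro v hv
    rw [LinearMap.mem_ker] at hv ⊢
    have := h v
    rw [hv, norm_zero, mul_zero] at this
    exact abs_eq_zero.1 (le_antisymm this (abs_nonneg _))
  -- `l` descends to the range of `j`, where it is bounded by `C`. The range need not be closed, so
  -- a norm-preserving extension to `H` precedes the Riesz theorem.
  let f : LinearMap.range j →ₗ[ℝ] ℝ :=
    (LinearMap.ker j).liftQ l hker ∘ₗ j.quotKerEquivRange.symm.toLinearMap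
  have hf : ∀ v, f ⟨j v, LinearMap.mem_range_self j v⟩ = l v := by
    intro v
    have : j.quotKerEquivRange.symm ⟨j v, LinearMap.mem_range_self j v⟩ =
        (LinearMap.ker j).mkQ v := by
      rw [LinearEquiv.symm_apply_eq]
      ext
      simp
    simp [f, this]
  have hfb : ∀ x, ‖f x‖ ≤ C * ‖x‖ := by
    rintro ⟨_, v, rfl⟩
    rw [hf]
    exact h v
  obtain ⟨g, hg, hgn⟩ := exists_extension_norm_eq (LinearMap.range j) (f.mkContinuous C hfb)
  refine ⟨(InnerProductSpace.toDual ℝ H).symm g, ?_, fun v => ?_⟩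
  · rw [LinearIsometryEquiv.norm_map, hgn]
    exact f.mkContinuous_norm_le hC hfb
  · rw [InnerProductSpace.toDual_symm_apply, ← hf v]
    exact (hg ⟨j v, LinearMap.mem_range_self j v⟩).symm

/-- A bounded family that converges weakly against a dense set converges weakly. -/
theorem tendsto_inner_of_dense {ι : Type*} {l : Filter ι} {f : ι → H} {g : H} {M : ℝ}
    (hM : ∀ᶠ i in l, ‖f i‖ ≤ M) {S : Set H} (hS : Dense S)
    (h : ∀ s ∈ S, Tendsto (fun i => inner ℝ (f i) s) l (𝓝 (inner ℝ g s))) (x : H) :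
    Tendsto (fun i => inner ℝ (f i) x) l (𝓝 (inner ℝ g x)) := by
  rw [Metric.tendsto_nhds]
  intro ε hε
  have hK : 0 < |M| + ‖g‖ + 1 := by positivity
  -- `|M| + ‖g‖` eventually bounds `‖f i - g‖`; the `+ 1` keeps the divisor positive.
  obtain ⟨s, hs, hxs⟩ := hS.exists_dist_lt x (ε := ε / 2 / (|M| + ‖g‖ + 1)) (by positivity)
  rw [dist_eq_norm, lt_div_iff₀ hK] at hxs
  filter_upwards [hM, Metric.tendsto_nhds.1 (h s hs) (ε / 2) (by positivity)] with i hi hi2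
  rw [Real.dist_eq] at hi2 ⊢
  have h1 : inner ℝ (f i) x - inner ℝ g x
      = inner ℝ (f i - g) (x - s) + (inner ℝ (f i) s - inner ℝ g s) := by
    simp only [inner_sub_left, inner_sub_right]; ring
  have h2 : |inner ℝ (f i - g) (x - s)| ≤ (|M| + ‖g‖ + 1) * ‖x - s‖ := by
    refine (abs_real_inner_le_norm _ _).trans ?_
    gcongr
    have := norm_sub_le (f i) g
    have := le_abs_self M
    linarith
  rw [h1]
  calc _ ≤ |inner ℝ (f i - g) (x - s)| + |inner ℝ (f i) s - inner ℝ g s| := abs_add_le _ _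
    _ < ε := by nlinarith

end Hilbert

/-! ### Convergence in `L²` -/

section L2

variable {α : Type*} [MeasurableSpace α] {μ : Measure α}
theorem eLpNorm_two_sq {F : Type*} [NormedAddCommGroup F] (f : α → F) :
    eLpNorm f 2 μ ^ 2 = ∫⁻ x, ‖f x‖ₑ ^ 2 ∂μ := by
  have := eLpNorm_nnreal_pow_eq_lintegral (μ := μ) (f := f) (p := 2) (by norm_num)
  simpa using this

theorem tendsto_eLpNorm_two_iff {F ι : Type*} [NormedAddCommGroup F] {l : Filter ι}
    {f : ι → α → F} : Tendsto (fun k => eLpNorm (f k) 2 μ) l (𝓝 0) ↔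
      Tendsto (fun k => ∫⁻ x, ‖f k x‖ₑ ^ 2 ∂μ) l (𝓝 0) := by
  simp_rw [← eLpNorm_two_sq]
  refine ⟨fun h => by
    simpa [Function.comp_def] using (ENNReal.continuous_pow 2).tendsto _ |>.comp h, fun h => ?_⟩
  have := (ENNReal.continuous_rpow_const (y := 1 / 2)).tendsto _ |>.comp h
  rw [ENNReal.zero_rpow_of_pos (by norm_num)] at this
  refine this.congr fun k => ?_
  simp only [Function.comp_apply]
  rw [← ENNReal.rpow_natCast, ← ENNReal.rpow_mul]
  norm_num

theorem tendsto_eLpNorm_add {F : Type*} [NormedAddCommGroup F] {f g : α → F} {fk gk : ℕ → α → F}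
    (hfm : ∀ k, AEStronglyMeasurable (fun x => f x - fk k x) μ)
    (hgm : ∀ k, AEStronglyMeasurable (fun x => g x - gk k x) μ)
    (hf : Tendsto (fun k => eLpNorm (fun x => f x - fk k x) 2 μ) atTop (𝓝 0))
    (hg : Tendsto (fun k => eLpNorm (fun x => g x - gk k x) 2 μ) atTop (𝓝 0)) :
    Tendsto (fun k => eLpNorm (fun x => (f x + g x) - (fk k x + gk k x)) 2 μ) atTop (𝓝 0) := by
  refine tendsto_of_tendsto_of_tendsto_of_le_of_le tendsto_const_nhds
    (by simpa using hf.add hg) (fun _ => zero_le) (fun k => ?_)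
  refine le_trans (le_of_eq ?_) (eLpNorm_add_le (hfm k) (hgm k) (by norm_num))
  congr 1
  ext x
  simp only [Pi.add_apply]
  abel

theorem tendsto_eLpNorm_sub {F : Type*} [NormedAddCommGroup F] {f g : α → F} {fk gk : ℕ → α → F}
    (hfm : ∀ k, AEStronglyMeasurable (fun x => f x - fk k x) μ)
    (hgm : ∀ k, AEStronglyMeasurable (fun x => g x - gk k x) μ)
    (hf : Tendsto (fun k => eLpNorm (fun x => f x - fk k x) 2 μ) atTop (𝓝 0))
    (hg : Tendsto (fun k => eLpNorm (fun x => g x - gk k x) 2 μ) atTop (𝓝 0)) :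
    Tendsto (fun k => eLpNorm (fun x => (f x - g x) - (fk k x - gk k x)) 2 μ) atTop (𝓝 0) := by
  refine tendsto_of_tendsto_of_tendsto_of_le_of_le tendsto_const_nhds
    (by simpa using hf.add hg) (fun _ => zero_le) (fun k => ?_)
  refine le_trans (le_of_eq ?_) (eLpNorm_sub_le (hfm k) (hgm k) (by norm_num))
  congr 1
  ext x
  simp only [Pi.sub_apply]
  abel

variable {F G W : Type*} [NormedAddCommGroup F] [NormedSpace ℝ F] [NormedAddCommGroup G]
  [NormedSpace ℝ G] [NormedAddCommGroup W] [NormedSpace ℝ W]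

/-- The pairing of two `L²` functions by a bounded bilinear map is integrable. -/
theorem integrable_bilin (B : F →L[ℝ] G →L[ℝ] W) {f : α → F} {g : α → G}
    (hf : MemLp f 2 μ) (hg : MemLp g 2 μ) : Integrable (fun x => B (f x) (g x)) μ := by
  rw [← memLp_one_iff_integrable]
  exact MemLp.of_bilin (fun x y => B x y) ‖B‖₊ hf hg
    (B.aestronglyMeasurable_comp₂ hf.1 hg.1) (.of_forall fun x => B.le_opNorm₂ _ _)

/-- `L²` convergence passes to integrals of a pairing with a fixed `L²` function. -/
theorem tendsto_integral_bilin [CompleteSpace W] (B : F →L[ℝ] G →L[ℝ] W) {f : α → F}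
    {g : α → G} {gk : ℕ → α → G} (hf : MemLp f 2 μ) (hg : AEStronglyMeasurable g μ)
    (hgk : ∀ k, AEStronglyMeasurable (gk k) μ)
    (hi : ∀ k, Integrable (fun x => B (f x) (gk k x)) μ)
    (h : Tendsto (fun k => eLpNorm (fun x => g x - gk k x) 2 μ) atTop (𝓝 0)) :
    Tendsto (fun k => ∫ x, B (f x) (gk k x) ∂μ) atTop (𝓝 (∫ x, B (f x) (g x) ∂μ)) := by
  refine tendsto_integral_of_L1' _ (B.aestronglyMeasurable_comp₂ hf.1 hg) (.of_forall hi) ?_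
  have hb : ∀ k, eLpNorm ((fun x => B (f x) (gk k x)) - fun x => B (f x) (g x)) 1 μ ≤
      ‖B‖₊ * eLpNorm f 2 μ * eLpNorm (fun x => g x - gk k x) 2 μ := by
    intro k
    rw [eLpNorm_sub_comm]
    have := eLpNorm_le_eLpNorm_mul_eLpNorm_of_nnnorm (p := 2) (q := 2) (r := 1) hf.1 (hg.sub (hgk k))
      (fun x y => B x y) ‖B‖₊ (.of_forall fun x => B.le_opNorm₂ _ _)
    refine le_trans (le_of_eq ?_) this
    congr 1
    ext x
    simp
  refine tendsto_of_tendsto_of_tendsto_of_le_of_le tendsto_const_nhds ?_ (fun _ => zero_le) hb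
  have := ENNReal.Tendsto.const_mul (a := ‖B‖₊ * eLpNorm f 2 μ) h
    (Or.inr (ENNReal.mul_ne_top (by simp) hf.2.ne))
  simpa using this

/-- `L²` limits of `A(f_k) g_k` for a bounded continuous operator-valued function `A`. -/
theorem tendsto_eLpNorm_apply {F : Type*} [NormedAddCommGroup F] {A : F → G →L[ℝ] W} (hA : Continuous A) {C : ℝ}
    (hC : ∀ z, ‖A z‖ ≤ C) {f : α → F} {fk : ℕ → α → F} {g : α → G} {gk : ℕ → α → G}
    (hf : AEStronglyMeasurable f μ) (hfk : ∀ k, AEStronglyMeasurable (fk k) μ)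
    (hg : MemLp g 2 μ) (hgk : ∀ k, AEStronglyMeasurable (gk k) μ)
    (hfl : Tendsto (fun k => eLpNorm (fun x => f x - fk k x) 2 μ) atTop (𝓝 0))
    (hgl : Tendsto (fun k => eLpNorm (fun x => g x - gk k x) 2 μ) atTop (𝓝 0)) :
    Tendsto (fun k => eLpNorm (fun x => A (f x) (g x) - A (fk k x) (gk k x)) 2 μ) atTop (𝓝 0) := by
  have happ : ∀ {u : α → F} {v : α → G}, AEStronglyMeasurable u μ → AEStronglyMeasurable v μ →
      AEStronglyMeasurable (fun x => A (u x) (v x)) μ := fun hu hv =>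
    isBoundedBilinearMap_apply.continuous.comp_aestronglyMeasurable
      ((hA.comp_aestronglyMeasurable hu).prodMk hv)
  have hC0 : 0 ≤ C := (norm_nonneg _).trans (hC 0)
  -- Split the difference as `(A(f) - A(f_k)) g + A(f_k) (g - g_k)`. The second term is controlled
  -- by the bound on `A`. In the first, `A` is merely continuous, so dominated convergence needs
  -- convergence almost everywhere, available only after passing to a further subsequence.
  refine tendsto_of_subseq_tendsto fun ns hns => ?_
  have hfl' := hfl.comp hns
  have hgl' := hgl.comp hns
  have hmeas : TendstoInMeasure μ (fun k => fk (ns k)) atTop f := by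
    refine tendstoInMeasure_of_tendsto_eLpNorm (p := 2) (by norm_num) (fun k => hfk _) hf ?_
    refine hfl'.congr fun k => ?_
    simp only [Function.comp_apply]
    exact (eLpNorm_sub_comm _ _ _ _)
  obtain ⟨ms, hms, hae⟩ := hmeas.exists_seq_tendsto_ae
  refine ⟨ms, ?_⟩
  have h1 : Tendsto (fun k => eLpNorm (fun x => A (f x) (g x) - A (fk (ns (ms k)) x) (g x)) 2 μ)
      atTop (𝓝 0) := by
    rw [tendsto_eLpNorm_two_iff]
    have hm : ∀ k, AEMeasurable (fun x => ‖A (f x) (g x) - A (fk (ns (ms k)) x) (g x)‖ₑ ^ 2) μ :=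
      fun k => ((happ hf hg.1).sub (happ (hfk _) hg.1)).enorm.pow_const 2
    rw [← lintegral_zero (μ := μ)]
    refine tendsto_lintegral_of_dominated_convergence'
      (fun x => (ENNReal.ofReal (C + C) * ‖g x‖ₑ) ^ 2) hm (fun k => .of_forall fun x => ?_) ?_ ?_
    · refine pow_le_pow_left₀ zero_le ?_ 2
      rw [← sub_apply, ← ofReal_norm, ← ofReal_norm,
        ← ENNReal.ofReal_mul (by positivity)]
      refine ENNReal.ofReal_le_ofReal (ContinuousLinearMap.le_of_opNorm_le _ ?_ _)
      exact (norm_sub_le _ _).trans (add_le_add (hC _) (hC _))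
    · simp_rw [mul_pow]
      rw [lintegral_const_mul'' _ (hg.1.enorm.pow_const 2), ← eLpNorm_two_sq]
      exact ENNReal.mul_ne_top (by simp) (by simp [hg.2.ne])
    · filter_upwards [hae] with x hx
      have h3 : Tendsto (fun k => A (f x) (g x) - A (fk (ns (ms k)) x) (g x)) atTop (𝓝 0) := by
        have := (((ContinuousLinearMap.apply ℝ W (g x)).continuous.comp hA).tendsto _).comp hx
        simpa [Function.comp_def] using (tendsto_const_nhds (x := A (f x) (g x))).sub this
      have := (continuous_enorm.tendsto _).comp h3
      simpa [Function.comp_def] using (ENNReal.continuous_pow 2).tendsto _ |>.comp this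
  have h2 : Tendsto (fun k => eLpNorm (fun x => A (fk (ns (ms k)) x) (g x - gk (ns (ms k)) x)) 2 μ)
      atTop (𝓝 0) := by
    have hb : ∀ k, eLpNorm (fun x => A (fk (ns (ms k)) x) (g x - gk (ns (ms k)) x)) 2 μ ≤
        ENNReal.ofReal C * eLpNorm (fun x => g x - gk (ns (ms k)) x) 2 μ := fun k =>
      eLpNorm_le_mul_eLpNorm_of_ae_le_mul (.of_forall fun x => by
        exact (A _).le_of_opNorm_le (hC _) _) _
    refine tendsto_of_tendsto_of_tendsto_of_le_of_le tendsto_const_nhds ?_ (fun _ => zero_le) hb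
    have := ENNReal.Tendsto.const_mul (a := ENNReal.ofReal C) (hgl'.comp hms.tendsto_atTop)
      (Or.inr (by simp))
    simpa using this
  have h12 := h1.add h2
  rw [add_zero] at h12
  refine tendsto_of_tendsto_of_tendsto_of_le_of_le tendsto_const_nhds h12 (fun _ => zero_le)
    (fun k => ?_)
  have h3 := happ (v := fun x => g x - gk (ns (ms k)) x) (hfk (ns (ms k))) (hg.1.sub (hgk _))
  have h4 := eLpNorm_add_le (p := 2) ((happ hf hg.1).sub (happ (hfk (ns (ms k))) hg.1)) h3
    (by norm_num)
  refine le_trans (le_of_eq ?_) h4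
  congr 1
  ext x
  simp

end L2

end DiffusionSystem

namespace DiffusionSystem

/-! ### Test functions and weak derivatives -/

section TestFun

variable {E F : Type*} [NormedAddCommGroup E] [NormedSpace ℝ E]
  [NormedAddCommGroup F] [NormedSpace ℝ F] {U : Set E}

theorem IsTestFun.fderiv_apply {φ : E → F} (h : IsTestFun U φ) (e : E) :
    IsTestFun U (fun x => fderiv ℝ φ x e) := by
  obtain ⟨h1, h2, h3⟩ := h
  have hs : tsupport (fun x => fderiv ℝ φ x e) ⊆ tsupport φ :=
    (closure_mono fun x hx => by
      rw [Function.mem_support] at hx ⊢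
      exact fun h0 => hx (by rw [h0]; rfl)).trans (tsupport_fderiv_subset ℝ)
  exact ⟨((contDiff_infty_iff_fderiv.1 h1).2).clm_apply contDiff_const,
    h2.of_isClosed_subset (isClosed_tsupport _) hs, hs.trans h3⟩

theorem IsTestFun.add {φ ψ : E → F} (h : IsTestFun U φ) (h' : IsTestFun U ψ) :
    IsTestFun U (φ + ψ) :=
  ⟨h.1.add h'.1, h.2.1.add h'.2.1,
    (tsupport_add _ _).trans (union_subset h.2.2 h'.2.2)⟩

theorem IsTestFun.const_smul {φ : E → F} (h : IsTestFun U φ) (c : ℝ) :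
    IsTestFun U (c • φ) :=
  ⟨h.1.const_smul c, h.2.1.smul_left (f := fun _ => c), (tsupport_smul_subset_right _ _).trans h.2.2⟩

theorem IsTestFun.smul_const {φ : E → ℝ} (h : IsTestFun U φ) (c : F) :
    IsTestFun U (fun x => φ x • c) :=
  ⟨h.1.smul contDiff_const, h.2.1.smul_right, (tsupport_smul_subset_left _ _).trans h.2.2⟩

variable [MeasurableSpace E] [BorelSpace E] {μ : Measure E}

theorem IsTestFun.memLp [IsFiniteMeasureOnCompacts μ] {φ : E → F} (h : IsTestFun U φ)
    (p : ℝ≥0∞) : MemLp φ p μ :=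
  h.1.continuous.memLp_of_hasCompactSupport h.2.1

theorem IsTestFun.memLp_fderiv [IsFiniteMeasureOnCompacts μ] {φ : E → F} (h : IsTestFun U φ)
    (p : ℝ≥0∞) : MemLp (fderiv ℝ φ) p μ :=
  (h.1.continuous_fderiv (by simp)).memLp_of_hasCompactSupport (h.2.1.fderiv ℝ)

theorem IsTestFun.continuous_smul {φ : E → ℝ} (h : IsTestFun U φ) (hU : IsOpen U) {ψ : E → F}
    (hψ : ContinuousOn ψ U) : Continuous (fun x => φ x • ψ x) :=
  continuous_of_tsupport fun _ hx =>
    (h.1.continuous.continuousAt).smul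
      (hψ.continuousAt (hU.mem_nhds (h.2.2 (tsupport_smul_subset_left φ ψ hx))))

theorem IsTestFun.integrable_smul [IsFiniteMeasureOnCompacts μ] {φ : E → ℝ} (h : IsTestFun U φ)
    (hU : IsOpen U) {ψ : E → F}
    (hψ : ContinuousOn ψ U) : Integrable (fun x => φ x • ψ x) μ :=
  (h.continuous_smul hU hψ).integrable_of_hasCompactSupport (h.2.1.smul_right)

theorem IsTestFun.setIntegral_smul {φ : E → ℝ} (h : IsTestFun U φ) (ψ : E → F) :
    ∫ x in U, φ x • ψ x ∂μ = ∫ x, φ x • ψ x ∂μ :=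
  setIntegral_eq_integral_of_forall_compl_eq_zero fun x hx => by
    rw [image_eq_zero_of_notMem_tsupport fun hx' => hx (h.2.2 hx'), zero_smul]

variable [FiniteDimensional ℝ E] [μ.IsAddHaarMeasure]

/-- Although `ψ` is regular only on `U`, the products with `φ` extend by zero to integrable
functions on the whole space, where integration by parts has no boundary term. -/
theorem IsTestFun.integral_fderiv_smul (hU : IsOpen U) {φ : E → ℝ} (h : IsTestFun U φ) {ψ : E → F}
    (hψ : ContDiffOn ℝ 1 ψ U) (e : E) :
    ∫ x in U, fderiv ℝ φ x e • ψ x ∂μ = - ∫ x in U, φ x • fderiv ℝ ψ x e ∂μ := by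
  rw [(h.fderiv_apply e).setIntegral_smul, h.setIntegral_smul, eq_comm, neg_eq_iff_eq_neg]
  have hd : ContinuousOn (fun x => fderiv ℝ ψ x e) U :=
    (hψ.continuousOn_fderiv_of_isOpen hU le_rfl).clm_apply continuousOn_const
  exact integral_bilinear_fderiv_right_eq_neg_left_of_integrable
    (B := ContinuousLinearMap.lsmul ℝ ℝ) ((h.fderiv_apply e).integrable_smul hU hψ.continuousOn)
    (h.integrable_smul hU hd) (h.integrable_smul hU hψ.continuousOn)
    (fun x _ => (h.1.differentiable (by simp)) x)
    (fun x hx => (hψ.differentiableOn one_ne_zero).differentiableAt (hU.mem_nhds (h.2.2 hx)))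

/-- An `L²` limit of `C¹` functions has the limit of the derivatives as weak derivative. -/
theorem IsTestFun.integral_fderiv_smul_of_tendsto [CompleteSpace F] (hU : IsOpen U) {e : E}
    {f g : E → F} {fk : ℕ → E → F} (hfk : ∀ k, ContDiffOn ℝ 1 (fk k) U)
    (hf : AEStronglyMeasurable f (μ.restrict U)) (hg : AEStronglyMeasurable g (μ.restrict U))
    (hfl : Tendsto (fun k => eLpNorm (fun x => f x - fk k x) 2 (μ.restrict U)) atTop (𝓝 0))
    (hgl : Tendsto (fun k => eLpNorm (fun x => g x - fderiv ℝ (fk k) x e) 2 (μ.restrict U))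
      atTop (𝓝 0)) {φ : E → ℝ} (h : IsTestFun U φ) :
    ∫ x in U, fderiv ℝ φ x e • f x ∂μ = - ∫ x in U, φ x • g x ∂μ := by
  have hd : ∀ k, ContinuousOn (fun x => fderiv ℝ (fk k) x e) U := fun k =>
    ((hfk k).continuousOn_fderiv_of_isOpen hU le_rfl).clm_apply continuousOn_const
  have h1 := tendsto_integral_bilin (ContinuousLinearMap.lsmul ℝ ℝ)
    ((h.fderiv_apply e).memLp (μ := μ.restrict U) 2) hf
    (fun k => (hfk k).continuousOn.aestronglyMeasurable hU.measurableSet)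
    (fun k => (h.fderiv_apply e).integrable_smul hU (hfk k).continuousOn) hfl
  have h2 := tendsto_integral_bilin (ContinuousLinearMap.lsmul ℝ ℝ)
    (h.memLp (μ := μ.restrict U) 2) hg
    (fun k => (hd k).aestronglyMeasurable hU.measurableSet)
    (fun k => h.integrable_smul hU (hd k)) hgl
  refine tendsto_nhds_unique h1 (h2.neg.congr fun k => ?_)
  exact (h.integral_fderiv_smul hU (hfk k) e).symm

/-- The fundamental lemma of the calculus of variations, applied to `f - g`. It gives uniqueness of
weak derivatives. -/
theorem ae_eq_of_forall_isTestFun [CompleteSpace F] (hU : IsOpen U) {f g : E → F}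
    (hf : LocallyIntegrableOn f U μ) (hg : LocallyIntegrableOn g U μ)
    (h : ∀ φ : E → ℝ, IsTestFun U φ → ∫ x in U, φ x • f x ∂μ = ∫ x in U, φ x • g x ∂μ) :
    f =ᵐ[μ.restrict U] g := by
  have := hU.ae_eq_zero_of_integral_contDiff_smul_eq_zero (hf.sub hg) (fun φ h1 h2 h3 => by
    have hφ : IsTestFun U φ := ⟨h1, h2, h3⟩
    have hi : ∀ {f : E → F}, LocallyIntegrableOn f U μ → Integrable (fun x => φ x • f x) μ := by
      intro f hf
      have := (hf.integrableOn_compact_subset h3 h2).continuousOn_smul h1.continuous.continuousOn h2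
      rwa [integrableOn_iff_integrable_of_support_subset] at this
      exact (Function.support_smul_subset_left _ _).trans (subset_tsupport _)
    have h4 := h φ hφ
    rw [hφ.setIntegral_smul, hφ.setIntegral_smul, ← sub_eq_zero, ← integral_sub (hi hf) (hi hg)]
      at h4
    rw [← h4]
    simp [smul_sub])
  rw [Filter.EventuallyEq, ae_restrict_iff' hU.measurableSet]
  filter_upwards [this] with x hx hxU
  exact sub_eq_zero.1 (hx hxU)

theorem MemLp.locallyIntegrableOn_of_restrict {f : E → F} (hf : MemLp f 2 (μ.restrict U)) :
    LocallyIntegrableOn f U μ :=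
  locallyIntegrableOn_of_locallyIntegrable_restrict (hf.locallyIntegrable (by norm_num))

/-- A compactly supported `C¹` function is uniformly approximated by test functions, together with
its derivative. -/
theorem exists_isTestFun_dist_le [CompleteSpace F] {f : E → F} (hf : ContDiff ℝ 1 f)
    (hc : HasCompactSupport f) {δ ε : ℝ} (hδ : 0 < δ)
    (hε : 0 < ε) : ∃ φ : E → F, IsTestFun (Metric.cthickening δ (tsupport f)) φ ∧
      ∀ x, dist (φ x) (f x) ≤ ε ∧ dist (fderiv ℝ φ x) (fderiv ℝ f x) ≤ ε := by
  obtain ⟨r1, hr1, h1⟩ := Metric.uniformContinuous_iff.1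
    (hc.uniformContinuous_of_continuous hf.continuous) ε hε
  obtain ⟨r2, hr2, h2⟩ := Metric.uniformContinuous_iff.1
    ((hc.fderiv ℝ).uniformContinuous_of_continuous (hf.continuous_fderiv one_ne_zero)) ε hε
  -- Mollification at scale `r`: `δ` limits the growth of the support, while `r1` and `r2` are
  -- moduli of uniform continuity of `f` and of its derivative for the error `ε`.
  set r := min δ (min r1 r2)
  have hr : 0 < r := by positivity
  let b : ContDiffBump (0 : E) := ⟨r / 2, r, by positivity, by linarith⟩
  let ν : Measure E := Measure.addHaar
  let φ : E → F := convolution (b.normed ν) f (ContinuousLinearMap.lsmul ℝ ℝ) ν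
  have hfl : LocallyIntegrable f ν := hf.continuous.locallyIntegrable
  have hbl : LocallyIntegrable (b.normed ν) ν := (b.continuous_normed).locallyIntegrable
  have hφ' : ∀ x, fderiv ℝ φ x =
      convolution (b.normed ν) (fderiv ℝ f) (ContinuousLinearMap.lsmul ℝ ℝ) ν x := by
    intro x
    rw [(hc.hasFDerivAt_convolution_right (ContinuousLinearMap.lsmul ℝ ℝ) hbl hf x).fderiv]
    simp only [convolution_def]
    congr 1
  refine ⟨φ, ⟨?_, ?_, ?_⟩, fun x => ⟨?_, ?_⟩⟩
  · exact b.hasCompactSupport_normed.contDiff_convolution_left _ b.contDiff_normed hfl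
  · exact b.hasCompactSupport_normed.convolution _ hc
  · refine closure_minimal ?_ Metric.isClosed_cthickening
    refine (support_convolution_subset _).trans ?_
    rintro _ ⟨y, hy, z, hz, rfl⟩
    refine Metric.mem_cthickening_of_dist_le _ z δ _ (subset_tsupport _ hz) ?_
    rw [b.support_normed_eq, mem_ball_zero_iff] at hy
    rw [dist_eq_norm]
    simpa using hy.le.trans (min_le_left _ _)
  · refine b.dist_normed_convolution_le hf.continuous.aestronglyMeasurable fun y hy => ?_
    exact (h1 (lt_of_lt_of_le hy ((min_le_right _ _).trans (min_le_left _ _)))).le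
  · rw [hφ']
    refine b.dist_normed_convolution_le
      (hf.continuous_fderiv one_ne_zero).aestronglyMeasurable fun y hy => ?_
    exact (h2 (lt_of_lt_of_le hy ((min_le_right _ _).trans (min_le_right _ _)))).le

end TestFun

/-- Uniform convergence with supports in a fixed compact set implies `L²` convergence. -/
theorem tendsto_eLpNorm_of_norm_le {E G : Type*} [TopologicalSpace E] [R1Space E]
    [MeasurableSpace E] [BorelSpace E] {μ : Measure E} [IsFiniteMeasureOnCompacts μ]
    [NormedAddCommGroup G] {K : Set E} (hK : IsCompact K) (hKc : IsClosed K) (h : ℕ → E → G)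
    (hb : ∀ (k : ℕ) (x : E), ‖h k x‖ ≤ 1 / ((k : ℝ) + 1))
    (h0 : ∀ (k : ℕ) (x : E), x ∉ K → h k x = 0) :
    Tendsto (fun k => eLpNorm (h k) 2 μ) atTop (𝓝 0) := by
  have hle : ∀ k : ℕ, eLpNorm (h k) 2 μ ≤
      μ K ^ (2 : ℝ)⁻¹ * ENNReal.ofReal (1 / ((k : ℝ) + 1)) := by
    intro k
    have : K.indicator (h k) = h k := indicator_eq_self.2 fun x hx => by
      by_contra hxK
      exact hx (h0 k x hxK)
    rw [← this, eLpNorm_indicator_eq_eLpNorm_restrict hKc.measurableSet]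
    have := eLpNorm_le_of_ae_bound (p := 2) (μ := μ.restrict K) (.of_forall (hb k))
    simpa using this
  refine tendsto_of_tendsto_of_tendsto_of_le_of_le tendsto_const_nhds ?_ (fun _ => zero_le) hle
  have h1 := ENNReal.tendsto_ofReal tendsto_one_div_add_atTop_nhds_zero_nat
  rw [ENNReal.ofReal_zero] at h1
  have := ENNReal.Tendsto.const_mul (a := μ K ^ (2 : ℝ)⁻¹) h1
    (Or.inr (ENNReal.rpow_ne_top_of_nonneg (by norm_num) hK.measure_lt_top.ne))
  simpa using this

/-- Compactly supported `C¹` functions belong to `H¹₀`. -/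
theorem isH10_of_contDiff {E F : Type*} [NormedAddCommGroup E] [NormedSpace ℝ E]
    [FiniteDimensional ℝ E] [MeasureSpace E] [BorelSpace E]
    [(volume : Measure E).IsAddHaarMeasure]
    [NormedAddCommGroup F] [NormedSpace ℝ F] [CompleteSpace F] {U : Set E} (hU : IsOpen U)
    {f : E → F} (hf : ContDiff ℝ 1 f) (hc : HasCompactSupport f) (hs : tsupport f ⊆ U) :
    IsH10 U f (fderiv ℝ f) := by
  have hf' := hf.continuous_fderiv one_ne_zero
  obtain ⟨δ, hδ, hδU⟩ := hc.isCompact.exists_cthickening_subset_open hU hs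
  set K := Metric.cthickening δ (tsupport f)
  have hK : IsCompact K := hc.isCompact.cthickening
  have hKc : IsClosed K := Metric.isClosed_cthickening
  refine ⟨hf.continuous.memLp_of_hasCompactSupport hc,
    hf'.memLp_of_hasCompactSupport (hc.fderiv ℝ), ?_⟩
  have hε : ∀ k : ℕ, (0 : ℝ) < 1 / (k + 1) := fun k => by positivity
  choose φ hφ hφd using fun k : ℕ => exists_isTestFun_dist_le hf hc hδ (hε k)
  have hKf : tsupport f ⊆ K := Metric.self_subset_cthickening _
  refine ⟨φ, fun k => ⟨(hφ k).1, (hφ k).2.1, (hφ k).2.2.trans hδU⟩,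
    tendsto_eLpNorm_of_norm_le hK hKc _ (fun k x => ?_) (fun k x hx => ?_),
    tendsto_eLpNorm_of_norm_le hK hKc _ (fun k x => ?_) (fun k x hx => ?_)⟩
  · rw [← dist_eq_norm, dist_comm]; exact (hφd k x).1
  · rw [image_eq_zero_of_notMem_tsupport fun h => hx (hKf h),
      image_eq_zero_of_notMem_tsupport fun h => hx ((hφ k).2.2 h), sub_zero]
  · rw [← dist_eq_norm, dist_comm]; exact (hφd k x).2
  · rw [image_eq_zero_of_notMem_tsupport fun h => hx (hKf (tsupport_fderiv_subset ℝ h)),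
      image_eq_zero_of_notMem_tsupport fun h => hx ((hφ k).2.2 (tsupport_fderiv_subset ℝ h)),
      sub_zero]

end DiffusionSystem

namespace DiffusionSystem

/-! ### Weak convergence in `L²(Ω)` -/

section L2Inner

variable {α : Type*} [MeasurableSpace α] {μ : Measure α}
variable {F : Type*} [NormedAddCommGroup F] [InnerProductSpace ℝ F]

theorem integrable_inner {f g : α → F} (hf : MemLp f 2 μ) (hg : MemLp g 2 μ) :
    Integrable (fun x => (inner ℝ (f x) (g x) : ℝ)) μ :=
  integrable_bilin (innerSL ℝ) hf hg

theorem inner_toLp {f g : α → F} (hf : MemLp f 2 μ) (hg : MemLp g 2 μ) :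
    inner ℝ (hf.toLp f) (hg.toLp g) = ∫ x, (inner ℝ (f x) (g x) : ℝ) ∂μ := by
  rw [L2.inner_def]
  refine integral_congr_ae ?_
  filter_upwards [hf.coeFn_toLp, hg.coeFn_toLp] with x h1 h2
  rw [h1, h2]

theorem abs_integral_inner_le {f g : α → F} (hf : MemLp f 2 μ) (hg : MemLp g 2 μ) :
    |∫ x, (inner ℝ (f x) (g x) : ℝ) ∂μ| ≤ (eLpNorm f 2 μ).toReal * (eLpNorm g 2 μ).toReal := by
  rw [← inner_toLp hf hg, ← Lp.norm_toLp f hf, ← Lp.norm_toLp g hg]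
  exact abs_real_inner_le_norm _ _

theorem tendsto_integral_inner_right {f g : α → F} {gk : ℕ → α → F} (hf : MemLp f 2 μ)
    (hg : MemLp g 2 μ) (hgk : ∀ k, MemLp (gk k) 2 μ)
    (h : Tendsto (fun k => eLpNorm (fun x => g x - gk k x) 2 μ) atTop (𝓝 0)) :
    Tendsto (fun k => ∫ x, (inner ℝ (f x) (gk k x) : ℝ) ∂μ) atTop
      (𝓝 (∫ x, (inner ℝ (f x) (g x) : ℝ) ∂μ)) :=
  tendsto_integral_bilin (innerSL ℝ) hf hg.1 (fun k => (hgk k).1)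
    (fun k => integrable_inner hf (hgk k)) h

end L2Inner

/-- The space `C_c^∞(U; F)`. -/
def testSpace {E : Type*} (F : Type*) [NormedAddCommGroup E] [NormedSpace ℝ E]
    [NormedAddCommGroup F] [NormedSpace ℝ F] (U : Set E) : Submodule ℝ (E → F) where
  carrier := {φ | IsTestFun U φ}
  add_mem' h h' := IsTestFun.add h h'
  zero_mem' := ⟨contDiff_const, HasCompactSupport.zero, by simp [tsupport_zero]⟩
  smul_mem' c _ h := IsTestFun.const_smul h c

section TestSpace

variable {E F : Type*} [NormedAddCommGroup E] [NormedSpace ℝ E] [MeasurableSpace E] [BorelSpace E]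
  [NormedAddCommGroup F] [InnerProductSpace ℝ F] {U : Set E} {μ : Measure E}
  [μ.IsAddHaarMeasure]

/-- The inclusion of the test functions in `L²`. -/
noncomputable def testToLp (F : Type*) [NormedAddCommGroup F] [InnerProductSpace ℝ F] (U : Set E)
    (μ : Measure E) [IsFiniteMeasureOnCompacts μ] : testSpace F U →ₗ[ℝ] Lp F 2 (μ.restrict U) where
  toFun φ := MemLp.toLp φ.1 (IsTestFun.memLp φ.2 2)
  map_add' φ ψ := (IsTestFun.memLp φ.2 2).toLp_add (IsTestFun.memLp ψ.2 2)
  map_smul' c φ := (IsTestFun.memLp φ.2 2).toLp_const_smul c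

theorem coeFn_testToLp (φ : testSpace F U) :
    testToLp F U μ φ =ᵐ[μ.restrict U] φ.1 :=
  MemLp.coeFn_toLp (IsTestFun.memLp φ.2 2)

/-- An `L²` function orthogonal to all test functions `φ c`, with `φ` scalar and `c` a fixed vector,
vanishes by the fundamental lemma. -/
theorem dense_range_testToLp [FiniteDimensional ℝ E] [CompleteSpace F]
    (hU : IsOpen U) : Dense (range (testToLp F U μ)) := by
  have h : Dense ((LinearMap.range (testToLp F U μ)) : Set (Lp F 2 (μ.restrict U))) := by
    rw [Submodule.dense_iff_topologicalClosure_eq_top, Submodule.topologicalClosure_eq_top_iff,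
      Submodule.eq_bot_iff]
    intro g hg
    rw [Submodule.mem_orthogonal] at hg
    have hgl := Lp.memLp g
    have h0 : (g : E → F) =ᵐ[μ.restrict U] fun _ => (0 : F) := by
      refine ae_eq_of_forall_isTestFun hU (MemLp.locallyIntegrableOn_of_restrict hgl)
        locallyIntegrableOn_zero fun φ hφ => ?_
      simp only [smul_zero, integral_zero]
      have hi : Integrable (fun x => φ x • g x) (μ.restrict U) :=
        integrable_bilin (ContinuousLinearMap.lsmul ℝ ℝ) (hφ.memLp 2) hgl
      refine ext_inner_left ℝ fun c => ?_
      rw [inner_zero_right, ← integral_inner hi]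
      have := hg _ ⟨⟨_, hφ.smul_const c⟩, rfl⟩
      rw [L2.inner_def] at this
      rw [← this]
      refine integral_congr_ae ?_
      filter_upwards [coeFn_testToLp (μ := μ) ⟨_, hφ.smul_const c⟩] with x hx
      rw [hx, inner_smul_left, inner_smul_right]
      simp
    exact (Lp.eq_zero_iff_ae_eq_zero).2 h0
  exact h

/-- Test functions are dense in `L²`, and for a bounded family weak convergence need only be checked
on a dense set. -/
theorem tendsto_integral_inner_of_isTestFun [FiniteDimensional ℝ E] [CompleteSpace F]
    (hU : IsOpen U) {ι : Type*} {l : Filter ι} {w : ι → E → F} {g : E → F} {M : ℝ≥0∞} (hM : M ≠ ⊤)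
    (hw : ∀ᶠ i in l, MemLp (w i) 2 (μ.restrict U) ∧ eLpNorm (w i) 2 (μ.restrict U) ≤ M)
    (hg : MemLp g 2 (μ.restrict U))
    (h : ∀ φ : E → F, IsTestFun U φ → Tendsto (fun i => ∫ x in U, (inner ℝ (w i x) (φ x) : ℝ) ∂μ) l
      (𝓝 (∫ x in U, (inner ℝ (g x) (φ x) : ℝ) ∂μ))) {ψ : E → F} (hψ : MemLp ψ 2 (μ.restrict U)) :
    Tendsto (fun i => ∫ x in U, (inner ℝ (w i x) (ψ x) : ℝ) ∂μ) l
      (𝓝 (∫ x in U, (inner ℝ (g x) (ψ x) : ℝ) ∂μ)) := by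
  classical
  -- The value `0` is a default for indices outside the eventual set on which `w i` lies in `L²`.
  let f : ι → Lp F 2 (μ.restrict U) := fun i =>
    if hi : MemLp (w i) 2 (μ.restrict U) then hi.toLp (w i) else 0
  have hf : ∀ {χ : E → F} (hχ : MemLp χ 2 (μ.restrict U)),
      ∀ᶠ i in l, inner ℝ (f i) (hχ.toLp χ) = ∫ x in U, (inner ℝ (w i x) (χ x) : ℝ) ∂μ := by
    intro χ hχ
    filter_upwards [hw] with i hi
    simp only [f, dif_pos hi.1]
    exact inner_toLp hi.1 hχ
  have hb : ∀ᶠ i in l, ‖f i‖ ≤ M.toReal := by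
    filter_upwards [hw] with i hi
    simp only [f, dif_pos hi.1, Lp.norm_toLp]
    exact ENNReal.toReal_mono hM hi.2
  have := tendsto_inner_of_dense hb (dense_range_testToLp (F := F) (μ := μ) hU) (g := hg.toLp g) ?_
    (hψ.toLp ψ)
  · rw [inner_toLp] at this
    exact this.congr' (hf hψ)
  · rintro _ ⟨φ, rfl⟩
    have h2 : MemLp φ.1 2 (μ.restrict U) := IsTestFun.memLp φ.2 2
    change Tendsto (fun i => inner ℝ (f i) (h2.toLp φ.1)) l (𝓝 (inner ℝ _ (h2.toLp φ.1)))
    rw [inner_toLp]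
    exact (h φ.1 φ.2).congr' ((hf h2).mono fun i hi => hi.symm)

/-- A bounded family in `L²` that converges against every test function has a weak limit. -/
theorem exists_weak_limit [FiniteDimensional ℝ E] [CompleteSpace F]
    (hU : IsOpen U) {ι : Type*} {l : Filter ι} [l.NeBot] {w : ι → E → F} {M : ℝ≥0∞} (hM : M ≠ ⊤)
    (hw : ∀ᶠ i in l, MemLp (w i) 2 (μ.restrict U) ∧ eLpNorm (w i) 2 (μ.restrict U) ≤ M)
    (h : ∀ φ : E → F, IsTestFun U φ →
      ∃ c, Tendsto (fun i => ∫ x in U, (inner ℝ (w i x) (φ x) : ℝ) ∂μ) l (𝓝 c)) :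
    ∃ g : E → F, MemLp g 2 (μ.restrict U) ∧ ∀ ψ : E → F, MemLp ψ 2 (μ.restrict U) →
      Tendsto (fun i => ∫ x in U, (inner ℝ (w i x) (ψ x) : ℝ) ∂μ) l
        (𝓝 (∫ x in U, (inner ℝ (g x) (ψ x) : ℝ) ∂μ)) := by
  choose! c hc using h
  have hmem : ∀ φ : testSpace F U, MemLp φ.1 2 (μ.restrict U) := fun φ => IsTestFun.memLp φ.2 2
  -- The limits form a linear functional bounded by `M` times the `L²` norm. The vector representing
  -- it is the weak limit.
  let L : testSpace F U →ₗ[ℝ] ℝ :=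
    { toFun := fun φ => c φ.1
      map_add' := fun φ ψ => by
        refine tendsto_nhds_unique (hc _ (φ + ψ).2)
          (((hc _ φ.2).add (hc _ ψ.2)).congr' ?_)
        filter_upwards [hw] with i hi
        rw [← integral_add (integrable_inner hi.1 (hmem φ)) (integrable_inner hi.1 (hmem ψ))]
        simp [inner_add_right]
      map_smul' := fun r φ => by
        refine tendsto_nhds_unique (hc _ (r • φ).2) (((hc _ φ.2).const_mul r).congr fun i => ?_)
        rw [← integral_const_mul]
        simp [inner_smul_right] }
  have hL : ∀ φ, |L φ| ≤ M.toReal * ‖testToLp F U μ φ‖ := fun φ => by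
    refine le_of_tendsto (hc _ φ.2).abs ?_
    filter_upwards [hw] with i hi
    refine (abs_integral_inner_le hi.1 (hmem φ)).trans ?_
    change _ ≤ M.toReal * ‖(hmem φ).toLp φ.1‖
    rw [Lp.norm_toLp]
    exact mul_le_mul_of_nonneg_right (ENNReal.toReal_mono hM hi.2) ENNReal.toReal_nonneg
  obtain ⟨g, -, hg⟩ := exists_inner_eq_of_le (testToLp F U μ) L ENNReal.toReal_nonneg hL
  refine ⟨g, Lp.memLp g, fun ψ hψ =>
    tendsto_integral_inner_of_isTestFun hU hM hw (Lp.memLp g) (fun φ hφ => ?_) hψ⟩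
  have h1 := hg ⟨φ, hφ⟩
  have h2 : inner ℝ g (testToLp F U μ ⟨φ, hφ⟩) = ∫ x in U, (inner ℝ (g x) (φ x) : ℝ) ∂μ := by
    rw [← inner_toLp (Lp.memLp g) (hmem ⟨φ, hφ⟩), Lp.toLp_coeFn]
    rfl
  rw [← h2, ← h1]
  exact hc φ hφ

end TestSpace

/-! ### The nonlinearity -/

section Potential

variable {E : Type*} [NormedAddCommGroup E] [InnerProductSpace ℝ E] [CompleteSpace E] {Φ : E → ℝ}

theorem contDiff_gradient (hΦ : ContDiff ℝ 2 Φ) : ContDiff ℝ 1 (gradient Φ) :=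
  (InnerProductSpace.toDual ℝ E).symm.contDiff.comp
    (hΦ.fderiv_right (m := 1) (by norm_num))

/-- Convexity is phrased with the second derivative of `Φ`, the equation with its gradient; this
passes between the two. -/
theorem inner_fderiv_gradient (hΦ : ContDiff ℝ 2 Φ) (z ξ η : E) :
    inner ℝ (fderiv ℝ (gradient Φ) z ξ) η = fderiv ℝ (fderiv ℝ Φ) z ξ η := by
  have h1 : DifferentiableAt ℝ (fderiv ℝ Φ) z :=
    ((hΦ.fderiv_right (m := 1) (by norm_num)).differentiable one_ne_zero) z
  have h2 := (((contDiff_gradient hΦ).differentiable one_ne_zero) z).hasFDerivAt.inner ℝ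
    (hasFDerivAt_const η z)
  have h3 : (fun z => inner ℝ (gradient Φ z) η) = fun z => fderiv ℝ Φ z η := by
    ext z
    simp [gradient, InnerProductSpace.toDual_symm_apply]
  rw [h3] at h2
  have h4 := h1.hasFDerivAt.clm_apply (hasFDerivAt_const η z)
  simpa using DFunLike.congr_fun (h2.unique h4) ξ

/-- The Hessian `B` is symmetric and nonnegative, so `0 ≤ B(ξ - η, ξ - η)` gives `2 B(ξ, η) ≤ B(ξ,
ξ) + B(η, η) ≤ 2 C` for unit vectors. Taking `η` along the image of `ξ` bounds the operator norm.
The absolute value matters only when `E` is trivial, since `C` may then be negative. -/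
theorem norm_fderiv_gradient_le (hΦ : ContDiff ℝ 2 Φ) {C : ℝ}
    (hC : ∀ z ξ : E, 0 ≤ fderiv ℝ (fderiv ℝ Φ) z ξ ξ ∧
      fderiv ℝ (fderiv ℝ Φ) z ξ ξ ≤ C * ‖ξ‖ ^ 2) (z : E) :
    ‖fderiv ℝ (gradient Φ) z‖ ≤ |C| := by
  have hsymm : ∀ ξ η, fderiv ℝ (fderiv ℝ Φ) z ξ η = fderiv ℝ (fderiv ℝ Φ) z η ξ := fun ξ η =>
    (hΦ.contDiffAt.isSymmSndFDerivAt (by simp)).eq ξ η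
  have hunit : ∀ ξ η : E, ‖ξ‖ = 1 → ‖η‖ = 1 → fderiv ℝ (fderiv ℝ Φ) z ξ η ≤ |C| := by
    intro ξ η h1 h2
    have h3 := (hC z (ξ - η)).1
    have h4 := (hC z ξ).2
    have h5 := (hC z η).2
    rw [h1] at h4
    rw [h2] at h5
    simp only [map_sub, sub_apply] at h3
    rw [hsymm η ξ] at h3
    have := le_abs_self C
    linarith
  refine ContinuousLinearMap.opNorm_le_of_unit_norm (abs_nonneg C) fun ξ hξ => ?_
  set y := fderiv ℝ (gradient Φ) z ξ with hy
  by_cases h0 : y = 0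
  · rw [h0, norm_zero]; exact abs_nonneg C
  · have hyn : ‖y‖ ≠ 0 := norm_ne_zero_iff.2 h0
    have h1 := hunit ξ (‖y‖⁻¹ • y) hξ (by rw [norm_smul, norm_inv, norm_norm,
      inv_mul_cancel₀ hyn])
    rw [← inner_fderiv_gradient hΦ, ← hy, inner_smul_right, real_inner_self_eq_norm_sq, sq,
      inv_mul_cancel_left₀ hyn] at h1
    exact h1

theorem norm_gradient_sub_le (hΦ : ContDiff ℝ 2 Φ) {C : ℝ}
    (hC : ∀ z, ‖fderiv ℝ (gradient Φ) z‖ ≤ C) (a b : E) :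
    ‖gradient Φ a - gradient Φ b‖ ≤ C * ‖a - b‖ :=
  convex_univ.norm_image_sub_le_of_norm_fderiv_le
    (fun x _ => ((contDiff_gradient hΦ).differentiable one_ne_zero) x) (fun x _ => hC x)
    (mem_univ _) (mem_univ _)

/-- On the segment from `b` to `a`, the component of the gradient along `a - b` has the Hessian form
as derivative, hence increases. -/
theorem inner_gradient_sub_nonneg (hΦ : ContDiff ℝ 2 Φ)
    (h : ∀ z ξ : E, 0 ≤ fderiv ℝ (fderiv ℝ Φ) z ξ ξ) (a b : E) :
    0 ≤ inner ℝ (a - b) (gradient Φ a - gradient Φ b) := by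
  let g : ℝ → ℝ := fun s => inner ℝ (a - b) (gradient Φ (b + s • (a - b)))
  have hg : ∀ s, HasDerivAt g (fderiv ℝ (fderiv ℝ Φ) (b + s • (a - b)) (a - b) (a - b)) s := by
    intro s
    have h1 : HasDerivAt (fun s : ℝ => b + s • (a - b)) (a - b) s := by
      simpa using ((hasDerivAt_id s).smul_const (a - b)).const_add b
    have h2 := (((contDiff_gradient hΦ).differentiable one_ne_zero)
      (b + s • (a - b))).hasFDerivAt.comp_hasDerivAt s h1
    have h3 := (hasDerivAt_const s (a - b)).inner ℝ h2
    rw [inner_zero_left, add_zero] at h3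
    rw [← inner_fderiv_gradient hΦ, real_inner_comm]
    exact h3
  have hm : Monotone g := monotone_of_deriv_nonneg (fun s => (hg s).differentiableAt) fun s => by
    rw [(hg s).deriv]
    exact h _ _
  have := hm (zero_le_one (α := ℝ))
  simp only [g, zero_smul, add_zero, one_smul, add_sub_cancel] at this
  rw [inner_sub_right]
  linarith

end Potential

end DiffusionSystem

namespace DiffusionSystem

/-! ### The space `V(Ω_T)` -/

theorem eLpNorm_two_le_of_lintegral_le {α F : Type*} [MeasurableSpace α] {μ : Measure α}
    [NormedAddCommGroup F] {f : α → F} {V : ℝ≥0∞} (h : ∫⁻ x, ‖f x‖ₑ ^ 2 ∂μ ≤ V) :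
    eLpNorm f 2 μ ≤ V ^ (2⁻¹ : ℝ) := by
  rw [← eLpNorm_two_sq] at h
  calc eLpNorm f 2 μ = (eLpNorm f 2 μ ^ 2) ^ (2⁻¹ : ℝ) := by
        rw [← ENNReal.rpow_natCast, ← ENNReal.rpow_mul]; norm_num
    _ ≤ V ^ (2⁻¹ : ℝ) := ENNReal.rpow_le_rpow h (by norm_num)

theorem memLp_two_of_tendsto {α F : Type*} [MeasurableSpace α] {μ : Measure α}
    [NormedAddCommGroup F] {f : α → F} {fk : ℕ → α → F} (hf : AEStronglyMeasurable f μ)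
    (hfk : ∀ k, MemLp (fk k) 2 μ)
    (h : Tendsto (fun k => eLpNorm (fun x => f x - fk k x) 2 μ) atTop (𝓝 0)) : MemLp f 2 μ := by
  obtain ⟨k, hk⟩ := (h.eventually (gt_mem_nhds one_pos)).exists
  have h1 : MemLp (fun x => f x - fk k x) 2 μ := ⟨hf.sub (hfk k).1, hk.trans ENNReal.one_lt_top⟩
  have h2 := h1.add (hfk k)
  rwa [show (fun x => f x - fk k x) + fk k = f by ext1 x; simp] at h2

variable {n N : ℕ} {Ω : Set (Euc n)} {T : ℝ}

theorem restrict_cyl : (volume : Measure (Euc n × ℝ)).restrict (cyl Ω T) =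
    (volume.restrict Ω).prod (volume.restrict (Ioo 0 T)) := by
  rw [cyl, Measure.volume_eq_prod, Measure.prod_restrict]

instance : (volume : Measure (Euc n × ℝ)).IsAddHaarMeasure := by
  rw [Measure.volume_eq_prod]
  infer_instance

theorem isOpen_cyl (hΩ : IsOpen Ω) : IsOpen (cyl Ω T) := hΩ.prod isOpen_Ioo

/-- A property that holds a.e. in the product holds a.e. in almost every slice. -/
theorem ae_ae_slice {α β : Type*} [MeasurableSpace α] [MeasurableSpace β] {μ : Measure α}
    {ν : Measure β} [SFinite μ] [SFinite ν] {p : α × β → Prop} (h : ∀ᵐ z ∂μ.prod ν, p z) :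
    ∀ᵐ t ∂ν, ∀ᵐ x ∂μ, p (x, t) := by
  rw [← Measure.prod_swap] at h
  exact Measure.ae_ae_of_ae_prod (ae_of_ae_map measurable_swap.aemeasurable h)

theorem aestronglyMeasurable_slice {α β F : Type*} [MeasurableSpace α] [MeasurableSpace β]
    {μ : Measure α} {ν : Measure β} [SFinite μ] [SFinite ν] [TopologicalSpace F]
    {f : α × β → F} (h : AEStronglyMeasurable f (μ.prod ν)) :
    ∀ᵐ t ∂ν, AEStronglyMeasurable (fun x => f (x, t)) μ :=
  h.prod_swap.prodMk_left

theorem hasFDerivAt_slice {φ : Euc n × ℝ → Euc N} {x : Euc n} {t : ℝ}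
    (h : DifferentiableAt ℝ φ (x, t)) :
    HasFDerivAt (fun y => φ (y, t))
      ((fderiv ℝ φ (x, t)).comp (ContinuousLinearMap.inl ℝ (Euc n) ℝ)) x :=
  HasFDerivAt.comp x h.hasFDerivAt (hasFDerivAt_prodMk_left x t)

theorem fderiv_slice_apply {φ : Euc n × ℝ → Euc N} {x : Euc n} {t : ℝ}
    (h : DifferentiableAt ℝ φ (x, t)) (α : Fin n) :
    fderiv ℝ (fun y => φ (y, t)) x (basisVec α) = spaceDeriv α φ (x, t) := by
  rw [(hasFDerivAt_slice h).fderiv]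
  simp [spaceDeriv]

theorem contDiffOn_slice {φ : Euc n × ℝ → Euc N} (h : ContDiffOn ℝ 1 φ (cyl Ω T)) {t : ℝ}
    (ht : t ∈ Ioo 0 T) : ContDiffOn ℝ 1 (fun x => φ (x, t)) Ω :=
  h.comp (contDiff_prodMk_left t).contDiffOn fun _ hx => ⟨hx, ht⟩

theorem differentiableAt_of_mem_cyl (hΩ : IsOpen Ω) {φ : Euc n × ℝ → Euc N}
    (h : ContDiffOn ℝ 1 φ (cyl Ω T)) {p : Euc n × ℝ} (hp : p ∈ cyl Ω T) :
    DifferentiableAt ℝ φ p :=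
  (h.differentiableOn one_ne_zero).differentiableAt ((isOpen_cyl hΩ).mem_nhds hp)

theorem continuousOn_spaceDeriv (hΩ : IsOpen Ω) {φ : Euc n × ℝ → Euc N}
    (h : ContDiffOn ℝ 1 φ (cyl Ω T)) (α : Fin n) : ContinuousOn (spaceDeriv α φ) (cyl Ω T) :=
  (h.continuousOn_fderiv_of_isOpen (isOpen_cyl hΩ) le_rfl).clm_apply continuousOn_const

/-- The functions `φ k` are `C¹` of finite norm and approximate `u`, with gradient `Du`, in
`V(Ω_T)`. -/
structure VApprox (Ω : Set (Euc n)) (T : ℝ) (u : Euc n × ℝ → Euc N) (Du : Fin n → Euc n × ℝ → Euc N)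
    (φ : ℕ → Euc n × ℝ → Euc N) : Prop where
  meas : AEStronglyMeasurable u (volume.restrict (cyl Ω T))
  meas_slice : ∀ t ∈ Ioo (0 : ℝ) T, AEStronglyMeasurable (fun x => u (x, t)) (volume.restrict Ω)
  meas_grad : ∀ α, AEStronglyMeasurable (Du α) (volume.restrict (cyl Ω T))
  contDiffOn : ∀ k, ContDiffOn ℝ 1 (φ k) (cyl Ω T)
  finite : ∀ k, vNormSq Ω T (φ k) (fun α => spaceDeriv α (φ k)) < ⊤
  tendsto : Tendsto (fun k => vNormSq Ω T (fun p => u p - φ k p)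
    (fun α p => Du α p - spaceDeriv α (φ k) p)) atTop (𝓝 0)

theorem MemV.exists_vApprox {u : Euc n × ℝ → Euc N} (h : MemV Ω T u) :
    ∃ Du φ, VApprox Ω T u Du φ := by
  obtain ⟨h1, h2, Du, h3, φ, h4, h5⟩ := h
  exact ⟨Du, φ, h1, h2, h3, fun k => (h4 k).1, fun k => (h4 k).2, h5⟩

theorem lintegral_slice_le_vNormSq {v : Euc n × ℝ → Euc N} {Dv : Fin n → Euc n × ℝ → Euc N}
    {t : ℝ} (ht : t ∈ Ioo 0 T) : ∫⁻ x in Ω, ‖v (x, t)‖ₑ ^ 2 ≤ vNormSq Ω T v Dv :=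
  (le_iSup₂ (f := fun t (_ : t ∈ Ioo 0 T) => ∫⁻ x in Ω, ‖v (x, t)‖ₑ ^ 2) t ht).trans
    le_self_add

theorem lintegral_grad_le_vNormSq {v : Euc n × ℝ → Euc N} {Dv : Fin n → Euc n × ℝ → Euc N}
    (α : Fin n) : ∫⁻ p in cyl Ω T, ‖Dv α p‖ₑ ^ 2 ≤ vNormSq Ω T v Dv :=
  (lintegral_mono fun p => Finset.single_le_sum (f := fun α => ‖Dv α p‖ₑ ^ 2)
    (fun _ _ => zero_le) (Finset.mem_univ α)).trans le_add_self

namespace VApprox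

variable {u : Euc n × ℝ → Euc N} {Du : Fin n → Euc n × ℝ → Euc N} {φ : ℕ → Euc n × ℝ → Euc N}

theorem memLp_approx_slice (hΩ : IsOpen Ω) (h : VApprox Ω T u Du φ) (k : ℕ) {t : ℝ}
    (ht : t ∈ Ioo 0 T) : MemLp (fun x => φ k (x, t)) 2 (volume.restrict Ω) := by
  refine ⟨(contDiffOn_slice (h.contDiffOn k) ht).continuousOn.aestronglyMeasurable
    hΩ.measurableSet, ?_⟩
  refine (eLpNorm_two_le_of_lintegral_le (lintegral_slice_le_vNormSq
    (Dv := fun α => spaceDeriv α (φ k)) ht)).trans_lt ?_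
  exact (ENNReal.rpow_lt_top_iff_of_pos (by norm_num)).2 (h.finite k)

theorem eLpNorm_slice_sub_le (_ : VApprox Ω T u Du φ) (k : ℕ) {t : ℝ} (ht : t ∈ Ioo 0 T) :
    eLpNorm (fun x => u (x, t) - φ k (x, t)) 2 (volume.restrict Ω) ≤
      vNormSq Ω T (fun p => u p - φ k p) (fun α p => Du α p - spaceDeriv α (φ k) p)
        ^ (2⁻¹ : ℝ) :=
  eLpNorm_two_le_of_lintegral_le
    (lintegral_slice_le_vNormSq (v := fun p => u p - φ k p) ht)

theorem tendsto_rpow (h : VApprox Ω T u Du φ) :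
    Tendsto (fun k => vNormSq Ω T (fun p => u p - φ k p)
      (fun α p => Du α p - spaceDeriv α (φ k) p) ^ (2⁻¹ : ℝ)) atTop (𝓝 0) := by
  have := (ENNReal.continuous_rpow_const (y := 2⁻¹)).tendsto _ |>.comp h.tendsto
  rwa [ENNReal.zero_rpow_of_pos (by norm_num)] at this

theorem tendsto_slice (h : VApprox Ω T u Du φ) {t : ℝ} (ht : t ∈ Ioo 0 T) :
    Tendsto (fun k => eLpNorm (fun x => u (x, t) - φ k (x, t)) 2 (volume.restrict Ω))
      atTop (𝓝 0) :=
  tendsto_of_tendsto_of_tendsto_of_le_of_le tendsto_const_nhds h.tendsto_rpow (fun _ => zero_le)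
    fun k => h.eLpNorm_slice_sub_le k ht

theorem memLp_slice (hΩ : IsOpen Ω) (h : VApprox Ω T u Du φ) {t : ℝ} (ht : t ∈ Ioo 0 T) :
    MemLp (fun x => u (x, t)) 2 (volume.restrict Ω) :=
  memLp_two_of_tendsto (h.meas_slice t ht) (fun k => h.memLp_approx_slice hΩ k ht)
    (h.tendsto_slice ht)

/-- Some approximant of finite norm lies within distance 1 of `u`, and the supremum over times in
the norm makes the resulting bound uniform in `t`. -/
theorem exists_bound (hΩ : IsOpen Ω) (h : VApprox Ω T u Du φ) : ∃ M : ℝ≥0∞, M ≠ ⊤ ∧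
    ∀ t ∈ Ioo 0 T, eLpNorm (fun x => u (x, t)) 2 (volume.restrict Ω) ≤ M := by
  obtain ⟨k, hk⟩ := (h.tendsto_rpow.eventually (gt_mem_nhds one_pos)).exists
  refine ⟨1 + vNormSq Ω T (φ k) (fun α => spaceDeriv α (φ k)) ^ (2⁻¹ : ℝ),
    ENNReal.add_ne_top.2 ⟨by simp, (ENNReal.rpow_lt_top_iff_of_pos (by norm_num)).2
      (h.finite k) |>.ne⟩, fun t ht => ?_⟩
  have h1 := eLpNorm_add_le (p := 2) (f := fun x => u (x, t) - φ k (x, t))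
    ((h.memLp_slice hΩ ht).1.sub (h.memLp_approx_slice hΩ k ht).1)
    (h.memLp_approx_slice hΩ k ht).1 (by norm_num)
  have h2 : ((fun x => u (x, t) - φ k (x, t)) + fun x => φ k (x, t)) = fun x => u (x, t) := by
    ext1 x; simp
  rw [h2] at h1
  exact h1.trans (add_le_add ((h.eLpNorm_slice_sub_le k ht).trans hk.le)
    (eLpNorm_two_le_of_lintegral_le (lintegral_slice_le_vNormSq ht)))

theorem tendsto_cyl (hΩ : IsOpen Ω) (h : VApprox Ω T u Du φ) :
    Tendsto (fun k => eLpNorm (fun p => u p - φ k p) 2 (volume.restrict (cyl Ω T)))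
      atTop (𝓝 0) := by
  rw [tendsto_eLpNorm_two_iff]
  have h1 : ∀ k, ∫⁻ p in cyl Ω T, ‖u p - φ k p‖ₑ ^ 2 ≤ vNormSq Ω T (fun p => u p - φ k p)
      (fun α p => Du α p - spaceDeriv α (φ k) p) * volume (Ioo 0 T) := by
    intro k
    have hm : AEMeasurable (fun p => ‖u p - φ k p‖ₑ ^ 2) (volume.restrict (cyl Ω T)) :=
      (h.meas.sub ((h.contDiffOn k).continuousOn.aestronglyMeasurable
        (isOpen_cyl hΩ).measurableSet)).enorm.pow_const 2
    rw [restrict_cyl] at hm ⊢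
    rw [lintegral_prod_symm _ hm, ← setLIntegral_const]
    exact setLIntegral_mono measurable_const fun t ht =>
      lintegral_slice_le_vNormSq (v := fun p => u p - φ k p) ht
  refine tendsto_of_tendsto_of_tendsto_of_le_of_le tendsto_const_nhds ?_ (fun _ => zero_le) h1
  have := ENNReal.Tendsto.mul_const (b := volume (Ioo 0 T)) h.tendsto (Or.inr (by simp))
  simpa using this

theorem tendsto_grad (h : VApprox Ω T u Du φ) (α : Fin n) :
    Tendsto (fun k => eLpNorm (fun p => Du α p - spaceDeriv α (φ k) p) 2
      (volume.restrict (cyl Ω T))) atTop (𝓝 0) := by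
  rw [tendsto_eLpNorm_two_iff]
  exact tendsto_of_tendsto_of_tendsto_of_le_of_le tendsto_const_nhds h.tendsto (fun _ => zero_le)
    fun k => lintegral_grad_le_vNormSq (Dv := fun α p => Du α p - spaceDeriv α (φ k) p) α

theorem memLp_grad (hΩ : IsOpen Ω) (h : VApprox Ω T u Du φ) (α : Fin n) :
    MemLp (Du α) 2 (volume.restrict (cyl Ω T)) := by
  refine memLp_two_of_tendsto (h.meas_grad α) (fun k => ⟨?_, ?_⟩) (h.tendsto_grad α)
  · exact (continuousOn_spaceDeriv hΩ (h.contDiffOn k) α).aestronglyMeasurable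
      (isOpen_cyl hΩ).measurableSet
  · refine (eLpNorm_two_le_of_lintegral_le (lintegral_grad_le_vNormSq (v := φ k)
      (Dv := fun α => spaceDeriv α (φ k)) α)).trans_lt ?_
    exact (ENNReal.rpow_lt_top_iff_of_pos (by norm_num)).2 (h.finite k)

/-- Functions in `V(Ω_T)` are weakly continuous in time. -/
theorem tendsto_integral_inner_slice (hΩ : IsOpen Ω) (h : VApprox Ω T u Du φ) {t : ℝ}
    (ht : t ∈ Ioo 0 T) {ψ : Euc n → Euc N} (hψ : MemLp ψ 2 (volume.restrict Ω)) :
    Tendsto (fun s => ∫ x in Ω, (inner ℝ (u (x, s)) (ψ x) : ℝ)) (𝓝[Ioo 0 T] t)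
      (𝓝 (∫ x in Ω, (inner ℝ (u (x, t)) (ψ x) : ℝ))) := by
  obtain ⟨M, hM, hb⟩ := h.exists_bound hΩ
  -- It suffices to pair with a test function `χ`. The pairings of the `C¹` approximants with `χ`
  -- are continuous in time, and they converge uniformly on `(0, T)` because the norm contains a
  -- supremum over all times.
  refine tendsto_integral_inner_of_isTestFun hΩ hM
    (eventually_mem_nhdsWithin.mono fun s hs => ⟨h.memLp_slice hΩ hs, hb s hs⟩)
    (h.memLp_slice hΩ ht) (fun χ hχ => ?_) hψ
  have hχ2 : MemLp χ 2 (volume.restrict Ω) := hχ.memLp 2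
  suffices hc : ContinuousOn (fun s => ∫ x in Ω, (inner ℝ (u (x, s)) (χ x) : ℝ)) (Ioo 0 T) from
    hc t ht
  have hk : ∀ k, ContinuousOn (fun s => ∫ x in Ω, (inner ℝ (φ k (x, s)) (χ x) : ℝ))
      (Ioo 0 T) := by
    intro k
    refine continuousOn_integral_of_compact_support (k := tsupport χ) hχ.2.1 ?_ ?_
    · rintro ⟨s, x⟩ ⟨hs, -⟩
      by_cases hx : x ∈ tsupport χ
      · have hp : (x, s) ∈ cyl Ω T := ⟨hχ.2.2 hx, hs⟩
        have h1 : ContinuousAt (fun q : ℝ × Euc n => φ k (q.2, q.1)) (s, x) :=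
          ContinuousAt.comp (f := fun q : ℝ × Euc n => (q.2, q.1)) (g := φ k)
            (((h.contDiffOn k).continuousOn).continuousAt ((isOpen_cyl hΩ).mem_nhds hp))
            (by fun_prop)
        exact (h1.inner (hχ.1.continuous.continuousAt.comp continuousAt_snd)).continuousWithinAt
      -- Here `φ k` may be irregular, as `x` may lie outside `Ω`, but the integrand vanishes near
      -- the point.
      · have hev : (fun q : ℝ × Euc n => (0 : ℝ)) =ᶠ[𝓝 (s, x)]
            Function.uncurry fun s x => (inner ℝ (φ k (x, s)) (χ x) : ℝ) := by
          have hc : ContinuousAt (Prod.snd : ℝ × Euc n → Euc n) (s, x) := continuousAt_snd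
          have := hc.eventually ((isClosed_tsupport χ).isOpen_compl.eventually_mem (x := x) hx)
          filter_upwards [this] with q hq
          simp only [Function.uncurry]
          rw [image_eq_zero_of_notMem_tsupport hq, inner_zero_right]
        exact (continuousAt_const.congr hev).continuousWithinAt
    · intro s x _ hx
      rw [image_eq_zero_of_notMem_tsupport hx, inner_zero_right]
  refine TendstoUniformlyOn.continuousOn
    (F := fun k s => ∫ x in Ω, (inner ℝ (φ k (x, s)) (χ x) : ℝ)) (p := atTop) ?_
    (Frequently.of_forall hk)
  rw [Metric.tendstoUniformlyOn_iff]
  intro ε hε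
  have hlim : Tendsto (fun k => vNormSq Ω T (fun p => u p - φ k p)
      (fun α p => Du α p - spaceDeriv α (φ k) p) ^ (2⁻¹ : ℝ) *
        eLpNorm χ 2 (volume.restrict Ω)) atTop (𝓝 0) := by
    have := ENNReal.Tendsto.mul_const (b := eLpNorm χ 2 (volume.restrict Ω)) h.tendsto_rpow
      (Or.inr hχ2.2.ne)
    simpa using this
  filter_upwards [hlim.eventually (gt_mem_nhds (ENNReal.ofReal_pos.2 hε))] with k hk s hs
  have h1 := h.memLp_slice hΩ hs
  have h2 := h.memLp_approx_slice hΩ k hs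
  have h3 := abs_integral_inner_le (h1.sub h2) hχ2
  rw [Real.dist_eq, ← integral_sub (integrable_inner h1 hχ2) (integrable_inner h2 hχ2)]
  simp_rw [← inner_sub_left]
  refine h3.trans_lt ?_
  rw [← ENNReal.toReal_mul, ← ENNReal.lt_ofReal_iff_toReal_lt]
  · refine lt_of_le_of_lt ?_ hk
    gcongr
    exact h.eLpNorm_slice_sub_le k hs
  · exact ENNReal.mul_ne_top (h1.sub h2).2.ne hχ2.2.ne

/-- Along a subsequence, the gradients converge in almost every time slice. -/
theorem exists_subseq (hΩ : IsOpen Ω) (h : VApprox Ω T u Du φ) : ∃ ns : ℕ → ℕ, StrictMono ns ∧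
    ∀ᵐ t ∂(volume.restrict (Ioo 0 T)), ∀ α, Tendsto (fun k => eLpNorm
      (fun x => Du α (x, t) - spaceDeriv α (φ (ns k)) (x, t)) 2 (volume.restrict Ω))
        atTop (𝓝 0) := by
  set a : ℕ → ℝ≥0∞ := fun k => ∫⁻ p in cyl Ω T, ∑ α, ‖Du α p - spaceDeriv α (φ k) p‖ₑ ^ 2 with ha
  have ha0 : Tendsto a atTop (𝓝 0) :=
    tendsto_of_tendsto_of_tendsto_of_le_of_le tendsto_const_nhds h.tendsto (fun _ => zero_le)
      fun k => le_add_self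
  -- Geometric decay makes the space-time errors summable. The sum over `j` of the slice errors then
  -- has finite integral in `t`, so it is finite for almost every `t`, and its terms tend to zero
  -- there.
  obtain ⟨ns, hns, hle⟩ := extraction_forall_of_eventually
    (P := fun j k => a k ≤ (2⁻¹ : ℝ≥0∞) ^ j) fun j =>
      (ha0.eventually (gt_mem_nhds (ENNReal.pow_pos (by norm_num) j))).mono fun k hk => hk.le
  refine ⟨ns, hns, ?_⟩
  have hm : ∀ k, AEMeasurable (fun p => ∑ α, ‖Du α p - spaceDeriv α (φ k) p‖ₑ ^ 2)
      ((volume.restrict Ω).prod (volume.restrict (Ioo 0 T))) := by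
    intro k
    rw [← restrict_cyl]
    exact Finset.aemeasurable_fun_sum _ fun α _ => ((h.meas_grad α).sub
      ((continuousOn_spaceDeriv hΩ (h.contDiffOn k) α).aestronglyMeasurable
        (isOpen_cyl hΩ).measurableSet)).enorm.pow_const 2
  have hsum : ∫⁻ t in Ioo 0 T, ∑' j, ∫⁻ x in Ω,
      ∑ α, ‖Du α (x, t) - spaceDeriv α (φ (ns j)) (x, t)‖ₑ ^ 2 ≠ ⊤ := by
    rw [lintegral_tsum fun j => (hm (ns j)).lintegral_prod_left']
    have h1 : ∀ j, ∫⁻ t in Ioo 0 T, ∫⁻ x in Ω,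
        ∑ α, ‖Du α (x, t) - spaceDeriv α (φ (ns j)) (x, t)‖ₑ ^ 2 = a (ns j) := by
      intro j
      rw [ha]
      simp only
      rw [restrict_cyl, lintegral_prod_symm _ (hm (ns j))]
    simp_rw [h1]
    refine ne_top_of_le_ne_top ?_ (ENNReal.tsum_le_tsum hle)
    rw [ENNReal.tsum_geometric]
    simp
  have hfin := ae_lt_top' (AEMeasurable.tsum fun j =>
    (hm (ns j)).lintegral_prod_left') hsum
  filter_upwards [hfin] with t ht α
  have := ENNReal.tendsto_atTop_zero_of_tsum_ne_top ht.ne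
  rw [tendsto_eLpNorm_two_iff]
  refine tendsto_of_tendsto_of_tendsto_of_le_of_le tendsto_const_nhds this (fun _ => zero_le)
    fun k => lintegral_mono fun x => ?_
  exact Finset.single_le_sum (f := fun α => ‖Du α (x, t) - spaceDeriv α (φ (ns k)) (x, t)‖ₑ ^ 2)
    (fun _ _ => zero_le) (Finset.mem_univ α)

/-- The chain rule for `P(u)`, `u ∈ V(Ω_T)`. -/
theorem weakDeriv_comp (hΩ : IsOpen Ω) (h : VApprox Ω T u Du φ) {P : Euc N → Euc N}
    (hP : ContDiff ℝ 1 P) {C : ℝ} (hC : ∀ z, ‖fderiv ℝ P z‖ ≤ C)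
    (hlip : ∀ a b, ‖P a - P b‖ ≤ C * ‖a - b‖) {α : Fin n} {Dv : Euc n × ℝ → Euc N}
    (hDv : HasWeakSpaceDeriv Ω T α (fun p => P (u p)) Dv) :
    Dv =ᵐ[volume.restrict (cyl Ω T)] fun p => fderiv ℝ P (u p) (Du α p) := by
  have hcyl := isOpen_cyl (T := T) hΩ
  have hA : Continuous (fderiv ℝ P) := hP.continuous_fderiv one_ne_zero
  have hg : MemLp (fun p => fderiv ℝ P (u p) (Du α p)) 2 (volume.restrict (cyl Ω T)) :=
    (h.memLp_grad hΩ α).of_le_mul (isBoundedBilinearMap_apply.continuous.comp_aestronglyMeasurable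
      ((hA.comp_aestronglyMeasurable h.meas).prodMk (h.meas_grad α)))
      (.of_forall fun p => ContinuousLinearMap.le_of_opNorm_le _ (hC _) _)
  have hmk : ∀ k, AEStronglyMeasurable (φ k) (volume.restrict (cyl Ω T)) := fun k =>
    (h.contDiffOn k).continuousOn.aestronglyMeasurable hcyl.measurableSet
  -- Both sides are weak derivatives of `P(u)`: the left by hypothesis, the right as the `L²` limit
  -- of the classical chain rule for `P(φ k)`.
  refine ae_eq_of_forall_isTestFun hcyl hDv.2.1 (MemLp.locallyIntegrableOn_of_restrict hg)
    fun χ hχ => ?_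
  rw [← neg_inj, ← hDv.2.2 χ hχ]
  refine hχ.integral_fderiv_smul_of_tendsto hcyl (fk := fun k p => P (φ k p))
    (e := (basisVec α, 0)) (fun k => hP.comp_contDiffOn (h.contDiffOn k))
    (hP.continuous.comp_aestronglyMeasurable h.meas) hg.1 ?_ ?_
  · have h1 : ∀ k, eLpNorm (fun p => P (u p) - P (φ k p)) 2 (volume.restrict (cyl Ω T)) ≤
        ENNReal.ofReal C * eLpNorm (fun p => u p - φ k p) 2 (volume.restrict (cyl Ω T)) :=
      fun k => eLpNorm_le_mul_eLpNorm_of_ae_le_mul (.of_forall fun p => hlip _ _) _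
    refine tendsto_of_tendsto_of_tendsto_of_le_of_le tendsto_const_nhds ?_ (fun _ => zero_le) h1
    have := ENNReal.Tendsto.const_mul (a := ENNReal.ofReal C) (h.tendsto_cyl hΩ)
      (Or.inr (by simp))
    simpa using this
  · refine (tendsto_eLpNorm_apply hA hC h.meas hmk (h.memLp_grad hΩ α)
      (fun k => (continuousOn_spaceDeriv hΩ (h.contDiffOn k) α).aestronglyMeasurable
        hcyl.measurableSet) (h.tendsto_cyl hΩ) (h.tendsto_grad α)).congr fun k => ?_
    refine eLpNorm_congr_ae ?_
    filter_upwards [ae_restrict_mem hcyl.measurableSet] with p hp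
    have := ((hP.differentiable one_ne_zero) (φ k p)).hasFDerivAt.comp p
      (differentiableAt_of_mem_cyl hΩ (h.contDiffOn k) hp).hasFDerivAt
    rw [show (fun p => P (φ k p)) = P ∘ φ k from rfl, this.fderiv]
    rfl

end VApprox

end DiffusionSystem

namespace DiffusionSystem

/-! ### Functions of time with a weak derivative -/

theorem exists_subset_Icc_of_isCompact {T : ℝ} (hT : 0 < T) {K : Set ℝ} (hK : IsCompact K)
    (hs : K ⊆ Ioo 0 T) : ∃ a b, 0 < a ∧ a < b ∧ b < T ∧ K ⊆ Icc a b := by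
  -- Keeping `a` below and `b` above `T / 2` ensures `a < b`, even for empty `K`.
  obtain ⟨a, ha, ha'⟩ : ∃ a ∈ Ioo 0 (T / 2), ∀ x ∈ K, a ≤ x := by
    rcases K.eq_empty_or_nonempty with rfl | hne
    · exact ⟨T / 4, ⟨by linarith, by linarith⟩, by simp⟩
    · obtain ⟨x, hx, hmin⟩ := hK.exists_isLeast hne
      have := hs hx
      refine ⟨min x (T / 4), ⟨lt_min this.1 (by linarith), ?_⟩, fun y hy =>
        (min_le_left _ _).trans (hmin hy)⟩
      exact (min_le_right _ _).trans_lt (by linarith)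
  obtain ⟨b, hb, hb'⟩ : ∃ b ∈ Ioo (T / 2) T, ∀ x ∈ K, x ≤ b := by
    rcases K.eq_empty_or_nonempty with rfl | hne
    · exact ⟨3 * T / 4, ⟨by linarith, by linarith⟩, by simp⟩
    · obtain ⟨x, hx, hmax⟩ := hK.exists_isGreatest hne
      have := hs hx
      refine ⟨max x (3 * T / 4), ⟨?_, max_lt this.2 (by linarith)⟩, fun y hy =>
        (hmax hy).trans (le_max_left _ _)⟩
      exact lt_of_lt_of_le (by linarith) (le_max_right _ _)
  exact ⟨a, b, ha.1, by linarith [ha.2, hb.1], hb.2, fun x hx => ⟨ha' x hx, hb' x hx⟩⟩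

theorem IsTestFun.integrable_mul {U : Set ℝ} {ψ f : ℝ → ℝ} {μ : Measure ℝ} (hψ : IsTestFun U ψ)
    (hf : Integrable f μ) : Integrable (fun t => ψ t * f t) μ := by
  obtain ⟨C, hC⟩ := hψ.1.continuous.bounded_above_of_compact_support hψ.2.1
  exact hf.bdd_mul hψ.1.continuous.aestronglyMeasurable (.of_forall hC)

/-- The antiderivative of a test function with integral zero is a test function. -/
theorem isTestFun_antideriv {T : ℝ} (hT : 0 < T) {g : ℝ → ℝ} (hg : IsTestFun (Ioo 0 T) g)
    (h0 : ∫ t in Ioo 0 T, g t = 0) : IsTestFun (Ioo 0 T) (fun t => ∫ s in (0 : ℝ)..t, g s) := by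
  obtain ⟨a, b, ha, hab, hb, hK⟩ := exists_subset_Icc_of_isCompact hT hg.2.1 hg.2.2
  have hz : ∀ s, s ∉ Icc a b → g s = 0 := fun s hs =>
    image_eq_zero_of_notMem_tsupport fun h => hs (hK h)
  have hgc := hg.1.continuous
  have hs : tsupport (fun t => ∫ s in (0 : ℝ)..t, g s) ⊆ Icc a b := by
    refine closure_minimal (fun t ht => ?_) isClosed_Icc
    rw [Function.mem_support] at ht
    by_contra htn
    apply ht
    rw [mem_Icc, not_and_or, not_le, not_le] at htn
    rcases htn with h | h
    · rw [intervalIntegral.integral_congr (g := fun _ => (0 : ℝ)), intervalIntegral.integral_zero]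
      intro s hs
      refine hz s fun hs' => ?_
      rcases mem_uIcc.1 hs with h' | h' <;> linarith [h'.1, h'.2, hs'.1]
    -- Beyond the support the primitive equals the full integral, which is zero by `h0`.
    · have h1 : ∫ s in t..T, g s = 0 := by
        rw [intervalIntegral.integral_congr (g := fun _ => (0 : ℝ)),
          intervalIntegral.integral_zero]
        intro s hs
        refine hz s fun hs' => ?_
        rcases mem_uIcc.1 hs with h' | h' <;> linarith [h'.1, h'.2, hs'.2]
      have h2 := intervalIntegral.integral_add_adjacent_intervals
        (hgc.intervalIntegrable 0 t) (hgc.intervalIntegrable (μ := volume) t T)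
      rw [h1, add_zero] at h2
      rw [h2, intervalIntegral.integral_of_le hT.le, integral_Ioc_eq_integral_Ioo, h0]
  refine ⟨?_, (isCompact_Icc).of_isClosed_subset (isClosed_tsupport _) hs,
    hs.trans fun t ht => ⟨ha.trans_le ht.1, ht.2.trans_lt hb⟩⟩
  rw [contDiff_infty_iff_deriv]
  refine ⟨fun t => (hgc.integral_hasStrictDerivAt 0 t).hasDerivAt.differentiableAt, ?_⟩
  have : deriv (fun t => ∫ s in (0 : ℝ)..t, g s) = g := by
    ext t
    exact hgc.deriv_integral _ 0 t
  rw [this]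
  exact hg.1

/-- The lemma of du Bois-Reymond. -/
theorem exists_eq_const_of_integral_deriv_eq_zero {T : ℝ} (hT : 0 < T) {h : ℝ → ℝ}
    (hc : ContinuousOn h (Ioo 0 T)) (hi : IntegrableOn h (Ioo 0 T))
    (h0 : ∀ η : ℝ → ℝ, IsTestFun (Ioo 0 T) η → ∫ t in Ioo 0 T, deriv η t * h t = 0) :
    ∃ c, ∀ t ∈ Ioo 0 T, h t = c := by
  obtain ⟨ρ, hρ, hρ1⟩ : ∃ ρ : ℝ → ℝ, IsTestFun (Ioo 0 T) ρ ∧ ∫ t in Ioo 0 T, ρ t = 1 := by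
    let b : ContDiffBump (T / 2) := ⟨T / 8, T / 4, by positivity, by linarith⟩
    have hs : tsupport (b.normed volume) ⊆ Ioo 0 T := by
      rw [b.tsupport_normed_eq, Real.closedBall_eq_Icc]
      change Icc (T / 2 - T / 4) (T / 2 + T / 4) ⊆ _
      exact fun t ht => ⟨by linarith [ht.1], by linarith [ht.2]⟩
    refine ⟨b.normed volume, ⟨b.contDiff_normed, b.hasCompactSupport_normed, hs⟩, ?_⟩
    rw [setIntegral_eq_integral_of_forall_compl_eq_zero fun x hx =>
      image_eq_zero_of_notMem_tsupport fun hx' => hx (hs hx')]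
    exact b.integral_normed
  set c := ∫ t in Ioo 0 T, ρ t * h t
  refine ⟨c, fun t ht => ?_⟩
  have hae : h =ᵐ[volume.restrict (Ioo 0 T)] fun _ => c := by
    refine ae_eq_of_forall_isTestFun isOpen_Ioo hi.locallyIntegrableOn
      (locallyIntegrableOn_const c) fun ψ hψ => ?_
    -- As `ρ` has mass 1, `ψ - m ρ` has mean zero and is the derivative of a test function. The
    -- hypothesis then says `∫ ψ h = m c`.
    set m := ∫ t in Ioo 0 T, ψ t
    have hg : IsTestFun (Ioo 0 T) (ψ + (-m) • ρ) := hψ.add (hρ.const_smul _)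
    have hg0 : ∫ t in Ioo 0 T, (ψ + (-m) • ρ) t = 0 := by
      simp only [Pi.add_apply, Pi.smul_apply, smul_eq_mul]
      rw [integral_add, integral_const_mul, hρ1]
      · simp [m]
      · exact (memLp_one_iff_integrable.1 (hψ.memLp 1))
      · exact (memLp_one_iff_integrable.1 (hρ.memLp 1)).const_mul _
    have h1 := h0 _ (isTestFun_antideriv hT hg hg0)
    have h2 : deriv (fun t => ∫ s in (0 : ℝ)..t, (ψ + (-m) • ρ) s) = ψ + (-m) • ρ := by
      ext t
      exact hg.1.continuous.deriv_integral _ 0 t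
    rw [h2] at h1
    simp only [Pi.add_apply, Pi.smul_apply, smul_eq_mul, add_mul, mul_assoc] at h1
    rw [integral_add (hψ.integrable_mul hi) ((hρ.integrable_mul hi).const_mul _), integral_const_mul] at h1
    simp only [smul_eq_mul]
    rw [integral_mul_const]
    linarith
  exact Measure.eqOn_open_of_ae_eq hae isOpen_Ioo hc continuousOn_const ht

/-- A continuous function with integrable weak derivative `-K` is an antiderivative of `-K`. -/
theorem exists_eq_const_sub_integral {T : ℝ} (hT : 0 < T) {F K : ℝ → ℝ}
    (hc : ContinuousOn F (Ioo 0 T)) (hi : IntegrableOn F (Ioo 0 T)) (hK : IntegrableOn K (Ioo 0 T))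
    (h0 : ∀ η : ℝ → ℝ, IsTestFun (Ioo 0 T) η →
      ∫ t in Ioo 0 T, deriv η t * F t = ∫ t in Ioo 0 T, η t * K t) :
    ContinuousOn (fun t => ∫ s in (0 : ℝ)..t, K s) (Icc 0 T) ∧
      ∃ c, ∀ t ∈ Ioo 0 T, F t = c - ∫ s in (0 : ℝ)..t, K s := by
  have hKi : IntervalIntegrable K volume 0 T :=
    (intervalIntegrable_iff_integrableOn_Ioo_of_le hT.le).2 hK
  have hac := hKi.absolutelyContinuousOnInterval_intervalIntegral (c := 0) left_mem_uIcc
  have hG : ContinuousOn (fun t => ∫ s in (0 : ℝ)..t, K s) (Icc 0 T) := by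
    rw [← uIcc_of_le hT.le]; exact hac.continuousOn
  refine ⟨hG, ?_⟩
  have hGi : IntegrableOn (fun t => ∫ s in (0 : ℝ)..t, K s) (Ioo 0 T) :=
    (hG.integrableOn_Icc).mono_set Ioo_subset_Icc_self
  -- `F` plus the primitive of `K` has zero weak derivative: integrate the absolutely continuous
  -- primitive by parts against `η`, which vanishes at `0` and `T`.
  obtain ⟨c, hc⟩ := exists_eq_const_of_integral_deriv_eq_zero hT
    (hc.add (hG.mono Ioo_subset_Icc_self)) (hi.add hGi) fun η hη => by
      have hη' : IsTestFun (Ioo 0 T) (deriv η) := by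
        have := hη.fderiv_apply 1
        simpa [fderiv_apply_one_eq_deriv] using this
      have hz : ∀ t, t ∉ Ioo 0 T → η t = 0 := fun t ht =>
        image_eq_zero_of_notMem_tsupport fun h => ht (hη.2.2 h)
      have hacη : AbsolutelyContinuousOnInterval η 0 T :=
        (hη.1.of_le (by exact_mod_cast le_top)).contDiffOn.absolutelyContinuousOnInterval
      have h1 := hacη.integral_deriv_mul_eq_sub hac
      rw [hz 0 (by simp), hz T (by simp)] at h1
      have h2 : ∫ x in (0 : ℝ)..T, (deriv η x * (∫ s in (0 : ℝ)..x, K s) +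
          η x * deriv (fun t => ∫ s in (0 : ℝ)..t, K s) x) =
          ∫ x in Ioo 0 T, (deriv η x * (∫ s in (0 : ℝ)..x, K s) + η x * K x) := by
        rw [← integral_Ioc_eq_integral_Ioo, ← intervalIntegral.integral_of_le hT.le]
        refine intervalIntegral.integral_congr_ae ?_
        filter_upwards [hKi.ae_hasDerivAt_integral] with x hx hxm
        rw [(hx (uIoc_subset_uIcc hxm) 0 left_mem_uIcc).deriv]
      rw [h2, integral_add (hη'.integrable_mul hGi) (hη.integrable_mul hK), ← h0 η hη] at h1
      simp only [Pi.add_apply, mul_add]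
      rw [integral_add (hη'.integrable_mul hi) (hη'.integrable_mul hGi)]
      linarith
  refine ⟨c, fun t ht => ?_⟩
  have := hc t ht
  simp only [Pi.add_apply] at this
  linarith

end DiffusionSystem

namespace DiffusionSystem

/-! ### Gradients as matrices -/

/-- The values of gradients of maps from `ℝ^n` to `ℝ^N`, with the Euclidean norm. -/
abbrev Mat (n N : ℕ) : Type := PiLp 2 (fun _ : Fin n => Euc N)

/-- The matrix of a linear map. -/
noncomputable def gradCLM (n N : ℕ) : (Euc n →L[ℝ] Euc N) →L[ℝ] Mat n N :=
  ((PiLp.continuousLinearEquiv 2 ℝ (fun _ : Fin n => Euc N)).symm :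
    (Fin n → Euc N) →L[ℝ] Mat n N).comp
    (ContinuousLinearMap.pi fun α => ContinuousLinearMap.apply ℝ (Euc N) (basisVec α))

/-- A family of functions as a function with values in the matrices. -/
def tupleMat {n N : ℕ} {X : Type*} (D : Fin n → X → Euc N) (p : X) : Mat n N :=
  WithLp.toLp 2 fun α => D α p

variable {n N : ℕ} {Ω : Set (Euc n)} {T : ℝ}

@[simp] theorem gradCLM_apply (G : Euc n →L[ℝ] Euc N) (α : Fin n) :
    gradCLM n N G α = G (basisVec α) := rfl

@[simp] theorem tupleMat_apply {X : Type*} (D : Fin n → X → Euc N) (p : X) (α : Fin n) :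
    tupleMat D p α = D α p := rfl

theorem enorm_mat_sq (A : Mat n N) : ‖A‖ₑ ^ 2 = ∑ α, ‖A α‖ₑ ^ 2 := by
  have h := PiLp.norm_sq_eq_of_L2 (fun _ : Fin n => Euc N) A
  simp only [← ofReal_norm, ← ENNReal.ofReal_pow (norm_nonneg _)]
  rw [h, ENNReal.ofReal_sum_of_nonneg fun _ _ => by positivity]

theorem memLp_tupleMat {X : Type*} [MeasurableSpace X] {μ : Measure X} {D : Fin n → X → Euc N}
    (h : ∀ α, MemLp (D α) 2 μ) : MemLp (tupleMat D) 2 μ :=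
  memLp_piLp_iff.2 h

theorem memLp_gradCLM {X : Type*} [MeasurableSpace X] {μ : Measure X}
    {G : X → Euc n →L[ℝ] Euc N} (h : MemLp G 2 μ) : MemLp (fun x => gradCLM n N (G x)) 2 μ :=
  (gradCLM n N).comp_memLp' h

theorem tendsto_eLpNorm_gradCLM {X : Type*} [MeasurableSpace X] {μ : Measure X}
    {G : X → Euc n →L[ℝ] Euc N} {Gk : ℕ → X → Euc n →L[ℝ] Euc N}
    (h : Tendsto (fun k => eLpNorm (fun x => G x - Gk k x) 2 μ) atTop (𝓝 0)) :
    Tendsto (fun k => eLpNorm (fun x => gradCLM n N (G x) - gradCLM n N (Gk k x)) 2 μ)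
      atTop (𝓝 0) := by
  have h1 : ∀ k, eLpNorm (fun x => gradCLM n N (G x) - gradCLM n N (Gk k x)) 2 μ ≤
      ENNReal.ofReal ‖gradCLM n N‖ * eLpNorm (fun x => G x - Gk k x) 2 μ := fun k =>
    eLpNorm_le_mul_eLpNorm_of_ae_le_mul (.of_forall fun x => by
      rw [← map_sub]; exact (gradCLM n N).le_opNorm _) _
  refine tendsto_of_tendsto_of_tendsto_of_le_of_le tendsto_const_nhds ?_ (fun _ => zero_le) h1
  have := ENNReal.Tendsto.const_mul (a := ENNReal.ofReal ‖gradCLM n N‖) h (Or.inr (by simp))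
  simpa using this

/-! ### Time regularity of weak solutions -/

theorem IsTestFun.isH10 {E F : Type*} [NormedAddCommGroup E] [NormedSpace ℝ E] [MeasureSpace E]
    [BorelSpace E] [IsFiniteMeasureOnCompacts (volume : Measure E)]
    [NormedAddCommGroup F] [NormedSpace ℝ F] {U : Set E} {f : E → F} (hf : IsTestFun U f) :
    IsH10 U f (fderiv ℝ f) :=
  ⟨hf.memLp 2, hf.memLp_fderiv 2, fun _ => f, fun _ => hf,
    tendsto_eLpNorm_two_iff.2 (by simp), tendsto_eLpNorm_two_iff.2 (by simp)⟩

theorem hasFDerivAt_smul_prod {φ : Euc n → Euc N} {η : ℝ → ℝ} (hφ : Differentiable ℝ φ)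
    (hη : Differentiable ℝ η) (p : Euc n × ℝ) :
    HasFDerivAt (fun p : Euc n × ℝ => η p.2 • φ p.1)
      (η p.2 • (fderiv ℝ φ p.1).comp (ContinuousLinearMap.fst ℝ (Euc n) ℝ) +
        ((fderiv ℝ η p.2).comp (ContinuousLinearMap.snd ℝ (Euc n) ℝ)).smulRight (φ p.1)) p :=
  ((hη p.2).hasFDerivAt.comp p hasFDerivAt_snd).smul ((hφ p.1).hasFDerivAt.comp p hasFDerivAt_fst)

theorem isTestFun_smul_prod {φ : Euc n → Euc N} {η : ℝ → ℝ} (hφ : IsTestFun Ω φ)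
    (hη : IsTestFun (Ioo 0 T) η) :
    IsTestFun (cyl Ω T) (fun p : Euc n × ℝ => η p.2 • φ p.1) := by
  have hs : tsupport (fun p : Euc n × ℝ => η p.2 • φ p.1) ⊆ tsupport φ ×ˢ tsupport η := by
    refine closure_minimal (fun p hp => ?_)
      ((isClosed_tsupport φ).prod (isClosed_tsupport η))
    rw [Function.mem_support, smul_ne_zero_iff] at hp
    exact ⟨subset_tsupport _ hp.2, subset_tsupport _ hp.1⟩
  exact ⟨(hη.1.comp contDiff_snd).smul (hφ.1.comp contDiff_fst),
    (hφ.2.1.isCompact.prod hη.2.1.isCompact).of_isClosed_subset (isClosed_tsupport _) hs,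
    hs.trans (prod_mono hφ.2.2 hη.2.2)⟩

theorem VApprox.memLp_cyl (hΩ : IsOpen Ω) {u : Euc n × ℝ → Euc N}
    {Du : Fin n → Euc n × ℝ → Euc N} {φ : ℕ → Euc n × ℝ → Euc N} (h : VApprox Ω T u Du φ) :
    MemLp u 2 (volume.restrict (cyl Ω T)) := by
  refine ⟨h.meas, ?_⟩
  obtain ⟨M, hM, hb⟩ := h.exists_bound hΩ
  have h1 : ∫⁻ p in cyl Ω T, ‖u p‖ₑ ^ 2 ≤ M ^ 2 * volume (Ioo 0 T) := by
    have hm : AEMeasurable (fun p => ‖u p‖ₑ ^ 2) (volume.restrict (cyl Ω T)) :=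
      h.meas.enorm.pow_const 2
    rw [restrict_cyl] at hm ⊢
    rw [lintegral_prod_symm _ hm, ← setLIntegral_const]
    refine setLIntegral_mono measurable_const fun t ht => ?_
    rw [← eLpNorm_two_sq (f := fun x => u (x, t))]
    exact pow_le_pow_left₀ zero_le (hb t ht) 2
  refine (eLpNorm_two_le_of_lintegral_le h1).trans_lt
    ((ENNReal.rpow_lt_top_iff_of_pos (by norm_num)).2 ?_)
  exact ENNReal.mul_lt_top (ENNReal.pow_lt_top hM.lt_top) (by simp)

/-- The pairing `∫_Ω D(x,t) · ∇φ(x) dx`. -/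
noncomputable def gradPair (Ω : Set (Euc n)) (D : Euc n × ℝ → Mat n N) (φ : Euc n → Euc N)
    (t : ℝ) : ℝ :=
  ∫ x in Ω, inner ℝ (D (x, t)) (gradCLM n N (fderiv ℝ φ x))

theorem integrable_inner_cyl {D : Euc n × ℝ → Mat n N}
    (hD : MemLp D 2 (volume.restrict (cyl Ω T))) {φ : Euc n → Euc N} (hφ : IsTestFun Ω φ) :
    Integrable (fun p : Euc n × ℝ => (inner ℝ (D p) (gradCLM n N (fderiv ℝ φ p.1)) : ℝ))
      ((volume.restrict Ω).prod (volume.restrict (Ioo 0 T))) := by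
  rw [restrict_cyl] at hD
  have h2 := memLp_gradCLM (hφ.memLp_fderiv (μ := volume.restrict Ω) 2)
  exact integrable_inner hD (h2.comp_fst (volume.restrict (Ioo 0 T)))

theorem integrableOn_gradPair {D : Euc n × ℝ → Mat n N}
    (hD : MemLp D 2 (volume.restrict (cyl Ω T))) {φ : Euc n → Euc N} (hφ : IsTestFun Ω φ) :
    IntegrableOn (gradPair Ω D φ) (Ioo 0 T) :=
  (integrable_inner_cyl hD hφ).integral_prod_right

/-! ### The equation tested with products of functions of time and space -/

section Solution

variable {u : Euc n × ℝ → Euc N} {Du Dv : Fin n → Euc n × ℝ → Euc N}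
  {ψ : ℕ → Euc n × ℝ → Euc N}

/-- The test function `η(t) φ(x)` separates the variables: `gradPair` with a minus sign is the weak
time derivative of the pairing of `u` with `φ`. -/
theorem integral_deriv_mul_eq (hΩ : IsOpen Ω) (hV : VApprox Ω T u Du ψ)
    (hDv : ∀ α, MemLp (Dv α) 2 (volume.restrict (cyl Ω T)))
    (hw : ∀ (w : Euc n × ℝ → Euc N) (W : Euc n × ℝ → (Euc n × ℝ) →L[ℝ] Euc N),
      IsH10 (cyl Ω T) w W → ∫ p in cyl Ω T, (- inner ℝ (u p) (W p (0, 1)) +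
        ∑ α, inner ℝ (Dv α p) (W p (basisVec α, 0))) = 0)
    {φ : Euc n → Euc N} (hφ : IsTestFun Ω φ) {η : ℝ → ℝ} (hη : IsTestFun (Ioo 0 T) η) :
    ∫ t in Ioo 0 T, deriv η t * ∫ x in Ω, (inner ℝ (u (x, t)) (φ x) : ℝ) =
      ∫ t in Ioo 0 T, η t * gradPair Ω (tupleMat Dv) φ t := by
  have htest := isTestFun_smul_prod hφ hη
  have h0 := hw _ _ htest.isH10
  have hφd : Differentiable ℝ φ := hφ.1.differentiable (by simp)
  have hηd : Differentiable ℝ η := hη.1.differentiable (by simp)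
  simp only [(hasFDerivAt_smul_prod hφd hηd _).fderiv] at h0
  have hint : ∀ p : Euc n × ℝ, (-inner ℝ (u p) ((η p.2 • (fderiv ℝ φ p.1).comp
      (ContinuousLinearMap.fst ℝ (Euc n) ℝ) + ((fderiv ℝ η p.2).comp
        (ContinuousLinearMap.snd ℝ (Euc n) ℝ)).smulRight (φ p.1)) (0, 1)) +
      ∑ α, inner ℝ (Dv α p) ((η p.2 • (fderiv ℝ φ p.1).comp
      (ContinuousLinearMap.fst ℝ (Euc n) ℝ) + ((fderiv ℝ η p.2).comp
        (ContinuousLinearMap.snd ℝ (Euc n) ℝ)).smulRight (φ p.1)) (basisVec α, 0)) : ℝ) =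
      -(inner ℝ (u p) (deriv η p.2 • φ p.1)) +
        inner ℝ (tupleMat Dv p) (η p.2 • gradCLM n N (fderiv ℝ φ p.1)) := by
    intro p
    simp [PiLp.inner_apply]
  simp only [hint] at h0
  have hη' : IsTestFun (Ioo 0 T) (deriv η) := by
    have := hη.fderiv_apply 1
    simpa [fderiv_apply_one_eq_deriv] using this
  have hu := hV.memLp_cyl hΩ
  have hD := memLp_tupleMat hDv
  rw [restrict_cyl] at h0 hu hD
  have hprod : ∀ {G : Type} [NormedAddCommGroup G] [NormedSpace ℝ G] {χ : Euc n → G} {θ : ℝ → ℝ},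
      MemLp χ 2 (volume.restrict Ω) → IsTestFun (Ioo 0 T) θ →
      MemLp (fun p : Euc n × ℝ => θ p.2 • χ p.1) 2
        ((volume.restrict Ω).prod (volume.restrict (Ioo 0 T))) := by
    intro G _ _ χ θ hχ hθ
    obtain ⟨C, hC⟩ := hθ.1.continuous.bounded_above_of_compact_support hθ.2.1
    have h1 := hχ.comp_fst (volume.restrict (Ioo 0 T))
    refine h1.of_le_mul (c := C) ((hθ.1.continuous.comp continuous_snd).aestronglyMeasurable.smul
      h1.1) (.of_forall fun p => ?_)
    rw [norm_smul]
    exact mul_le_mul_of_nonneg_right (hC _) (norm_nonneg _)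
  have i1 := integrable_inner hu (hprod (hφ.memLp (μ := volume.restrict Ω) 2) hη')
  have i2 := integrable_inner hD
    (hprod (memLp_gradCLM (hφ.memLp_fderiv (μ := volume.restrict Ω) 2)) hη)
  rw [integral_add i1.fun_neg i2, integral_neg, integral_prod_symm _ i1, integral_prod_symm _ i2] at h0
  simp only [inner_smul_right, integral_const_mul] at h0
  simp only [gradPair]
  linarith

/-- The integrated form of the equation. -/
theorem exists_integral_inner_eq (hΩ : IsOpen Ω) (hT : 0 < T) (hV : VApprox Ω T u Du ψ)
    (hDv : ∀ α, MemLp (Dv α) 2 (volume.restrict (cyl Ω T)))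
    (hw : ∀ (w : Euc n × ℝ → Euc N) (W : Euc n × ℝ → (Euc n × ℝ) →L[ℝ] Euc N),
      IsH10 (cyl Ω T) w W → ∫ p in cyl Ω T, (- inner ℝ (u p) (W p (0, 1)) +
        ∑ α, inner ℝ (Dv α p) (W p (basisVec α, 0))) = 0)
    {φ : Euc n → Euc N} (hφ : IsTestFun Ω φ) :
    ∃ c, ∀ t ∈ Icc 0 T, Tendsto (fun s => ∫ x in Ω, (inner ℝ (u (x, s)) (φ x) : ℝ))
      (𝓝[Ioo 0 T] t) (𝓝 (c - ∫ s in (0 : ℝ)..t, gradPair Ω (tupleMat Dv) φ s)) := by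
  have hφ2 : MemLp φ 2 (volume.restrict Ω) := hφ.memLp 2
  have hc : ContinuousOn (fun s => ∫ x in Ω, (inner ℝ (u (x, s)) (φ x) : ℝ)) (Ioo 0 T) :=
    fun t ht => hV.tendsto_integral_inner_slice hΩ ht hφ2
  obtain ⟨M, hM, hb⟩ := hV.exists_bound hΩ
  have hi : IntegrableOn (fun s => ∫ x in Ω, (inner ℝ (u (x, s)) (φ x) : ℝ)) (Ioo 0 T) := by
    refine ⟨hc.aestronglyMeasurable measurableSet_Ioo, HasFiniteIntegral.of_bounded (C := M.toReal *
      (eLpNorm φ 2 (volume.restrict Ω)).toReal) ?_⟩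
    filter_upwards [ae_restrict_mem measurableSet_Ioo] with t ht
    refine (abs_integral_inner_le (hV.memLp_slice hΩ ht) hφ2).trans ?_
    exact mul_le_mul_of_nonneg_right (ENNReal.toReal_mono hM (hb t ht)) ENNReal.toReal_nonneg
  obtain ⟨hcont, c, hcF⟩ := exists_eq_const_sub_integral hT hc hi
    (integrableOn_gradPair (memLp_tupleMat hDv) hφ)
    fun η hη => integral_deriv_mul_eq hΩ hV hDv hw hφ hη
  refine ⟨c, fun t ht => ?_⟩
  refine Tendsto.congr' ?_ (tendsto_const_nhds.sub
    ((hcont t ht).mono_left (nhdsWithin_mono t Ioo_subset_Icc_self)))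
  filter_upwards [self_mem_nhdsWithin] with s hs
  exact (hcF s hs).symm

theorem nhdsWithin_Ioo_neBot (hT : 0 < T) {t : ℝ} (ht : t ∈ Icc 0 T) : (𝓝[Ioo 0 T] t).NeBot := by
  rw [← mem_closure_iff_nhdsWithin_neBot, closure_Ioo hT.ne]
  exact ht

/-- The slices are bounded in `L²`, and by the integrated equation their pairings with test
functions converge, also at the endpoints `0` and `T`. -/
theorem exists_isTimeValue (hΩ : IsOpen Ω) (hT : 0 < T) (hV : VApprox Ω T u Du ψ)
    (hDv : ∀ α, MemLp (Dv α) 2 (volume.restrict (cyl Ω T)))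
    (hw : ∀ (w : Euc n × ℝ → Euc N) (W : Euc n × ℝ → (Euc n × ℝ) →L[ℝ] Euc N),
      IsH10 (cyl Ω T) w W → ∫ p in cyl Ω T, (- inner ℝ (u p) (W p (0, 1)) +
        ∑ α, inner ℝ (Dv α p) (W p (basisVec α, 0))) = 0) {t : ℝ} (ht : t ∈ Icc 0 T) :
    ∃ g, IsTimeValue Ω T u t g := by
  obtain ⟨M, hM, hb⟩ := hV.exists_bound hΩ
  have := nhdsWithin_Ioo_neBot hT ht
  exact exists_weak_limit hΩ hM
    (eventually_mem_nhdsWithin.mono fun s hs => ⟨hV.memLp_slice hΩ hs, hb s hs⟩) fun φ hφ =>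
      let ⟨_, hc⟩ := exists_integral_inner_eq hΩ hT hV hDv hw hφ
      ⟨_, hc t ht⟩

/-- The integrated form of the equation between two times. -/
theorem IsTimeValue.integral_inner_sub (hΩ : IsOpen Ω) (hT : 0 < T) (hV : VApprox Ω T u Du ψ)
    (hDv : ∀ α, MemLp (Dv α) 2 (volume.restrict (cyl Ω T)))
    (hw : ∀ (w : Euc n × ℝ → Euc N) (W : Euc n × ℝ → (Euc n × ℝ) →L[ℝ] Euc N),
      IsH10 (cyl Ω T) w W → ∫ p in cyl Ω T, (- inner ℝ (u p) (W p (0, 1)) +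
        ∑ α, inner ℝ (Dv α p) (W p (basisVec α, 0))) = 0) {s t : ℝ} (hs : s ∈ Icc 0 T)
    (ht : t ∈ Icc 0 T) {a b : Euc n → Euc N} (ha : IsTimeValue Ω T u s a)
    (hb : IsTimeValue Ω T u t b) {φ : Euc n → Euc N} (hφ : IsTestFun Ω φ) :
    ∫ x in Ω, (inner ℝ (b x) (φ x) : ℝ) = (∫ x in Ω, (inner ℝ (a x) (φ x) : ℝ)) -
      ∫ r in s..t, gradPair Ω (tupleMat Dv) φ r := by
  obtain ⟨c, hc⟩ := exists_integral_inner_eq hΩ hT hV hDv hw hφ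
  have := nhdsWithin_Ioo_neBot hT hs
  have := nhdsWithin_Ioo_neBot hT ht
  have h1 := tendsto_nhds_unique (ha.2 φ (hφ.memLp 2)) (hc s hs)
  have h2 := tendsto_nhds_unique (hb.2 φ (hφ.memLp 2)) (hc t ht)
  have hi : IntervalIntegrable (gradPair Ω (tupleMat Dv) φ) volume 0 T :=
    (intervalIntegrable_iff_integrableOn_Ioo_of_le hT.le).2
      (integrableOn_gradPair (memLp_tupleMat hDv) hφ)
  have h0s := hi.mono_set (c := 0) (d := s) (by
    rw [uIcc_of_le hs.1, uIcc_of_le hT.le]; exact Icc_subset_Icc_right hs.2)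
  have h0t := hi.mono_set (c := 0) (d := t) (by
    rw [uIcc_of_le ht.1, uIcc_of_le hT.le]; exact Icc_subset_Icc_right ht.2)
  rw [h1, h2, ← intervalIntegral.integral_interval_sub_left h0t h0s]
  ring

end Solution

end DiffusionSystem

namespace DiffusionSystem

/-! ### The energy identity -/

/-- `F = a - ∫ q` is absolutely continuous with `F' = -q` almost everywhere, so this is the integral
of `(F²)' = -2 F q`. -/
theorem sq_sub_integral_eq {q : ℝ → ℝ} {s t : ℝ}
    (hq : IntervalIntegrable q volume s t) (a : ℝ) :
    (IntervalIntegrable (fun r => (a - ∫ r' in s..r, q r') * q r) volume s t) ∧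
    (a - ∫ r in s..t, q r) ^ 2 = a ^ 2 - 2 * ∫ r in s..t, (a - ∫ r' in s..r, q r') * q r := by
  have hac := hq.absolutelyContinuousOnInterval_intervalIntegral (c := s) left_mem_uIcc
  have hacF : AbsolutelyContinuousOnInterval (fun r => a - ∫ r' in s..r, q r') s t :=
    (contDiff_const (c := a)).contDiffOn.absolutelyContinuousOnInterval.fun_sub hac
  have hi : IntervalIntegrable (fun r => (a - ∫ r' in s..r, q r') * q r) volume s t :=
    hq.continuousOn_mul hacF.continuousOn
  refine ⟨hi, ?_⟩
  have h1 := hacF.integral_deriv_mul_eq_sub hacF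
  have h2 : ∫ x in s..t, (deriv (fun r => a - ∫ r' in s..r, q r') x * (a - ∫ r' in s..x, q r') +
      (a - ∫ r' in s..x, q r') * deriv (fun r => a - ∫ r' in s..r, q r') x) =
      ∫ x in s..t, (-2) * ((a - ∫ r' in s..x, q r') * q x) := by
    refine intervalIntegral.integral_congr_ae ?_
    filter_upwards [hq.ae_hasDerivAt_integral] with x hx hxm
    have := (hx (uIoc_subset_uIcc hxm) s left_mem_uIcc).const_sub a
    rw [this.deriv]
    ring
  rw [h2, intervalIntegral.integral_const_mul, intervalIntegral.integral_same] at h1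
  linarith

variable {H : Type*} [NormedAddCommGroup H] [InnerProductSpace ℝ H] [FiniteDimensional ℝ H]

/-- The scalar identity summed over an orthonormal basis. -/
theorem norm_sq_sub_integral_eq {q : ℝ → H} {s t : ℝ}
    (hq : IntervalIntegrable q volume s t) (a : H) :
    ‖a - ∫ r in s..t, q r‖ ^ 2 =
      ‖a‖ ^ 2 - 2 * ∫ r in s..t, (inner ℝ (a - ∫ r' in s..r, q r') (q r) : ℝ) := by
  have := FiniteDimensional.complete ℝ H
  let b := stdOrthonormalBasis ℝ H
  have hqi : ∀ i, IntervalIntegrable (fun r => (inner ℝ (b i) (q r) : ℝ)) volume s t := fun i =>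
    ⟨hq.1.const_inner _, hq.2.const_inner _⟩
  have hcomm : ∀ i, ∀ r ∈ uIcc s t, inner ℝ (b i) (a - ∫ r' in s..r, q r') =
      inner ℝ (b i) a - ∫ r' in s..r, (inner ℝ (b i) (q r') : ℝ) := by
    intro i r hr
    rw [inner_sub_right]
    congr 1
    exact ((innerSL ℝ (b i)).intervalIntegral_comp_comm
      (hq.mono_set (uIcc_subset_uIcc_left hr))).symm
  have key := fun i => sq_sub_integral_eq (hqi i) (inner ℝ (b i) a)
  have h2 : ∫ r in s..t, (inner ℝ (a - ∫ r' in s..r, q r') (q r) : ℝ) =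
      ∑ i, ∫ r in s..t, (inner ℝ (b i) a - ∫ r' in s..r, (inner ℝ (b i) (q r') : ℝ)) *
        (inner ℝ (b i) (q r) : ℝ) := by
    rw [← intervalIntegral.integral_finsetSum fun i _ => (key i).1]
    refine intervalIntegral.integral_congr fun r hr => ?_
    rw [← b.sum_inner_mul_inner]
    refine Finset.sum_congr rfl fun i _ => ?_
    rw [← hcomm i r hr, real_inner_comm (b i)]
  rw [h2, ← b.sum_sq_inner_right, ← b.sum_sq_inner_right a, Finset.mul_sum,
    ← Finset.sum_sub_distrib]
  refine Finset.sum_congr rfl fun i _ => ?_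
  rw [hcomm i t right_mem_uIcc, (key i).2]

/-- The primitive in time of `q`. -/
noncomputable def primitive {X : Type*} (ν : Measure ℝ) (q : X × ℝ → H) (p : X × ℝ) : H :=
  ∫ r in Iic p.2, q (p.1, r) ∂ν

/-! ### Measurability and `L²` bounds of primitives in time -/

section Primitive

variable {X : Type*} [MeasurableSpace X] {μ : Measure X} [SFinite μ] {ν : Measure ℝ}
  [IsFiniteMeasure ν] {q : X × ℝ → H}

theorem primitive_eq_intervalIntegral {s t r : ℝ} (hr : r ∈ Icc s t) (x : X) :
    primitive (volume.restrict (Ioc s t)) q (x, r) = ∫ r' in s..r, q (x, r') := by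
  rw [primitive, Measure.restrict_restrict measurableSet_Iic,
    intervalIntegral.integral_of_le hr.1]
  congr 2
  ext y
  simp only [mem_inter_iff, mem_Iic, mem_Ioc]
  exact ⟨fun h => ⟨h.2.1, h.1⟩, fun h => ⟨h.2, h.1, h.2.trans hr.2⟩⟩

/-- The primitive integrates out `r'` from `q(x, r')` cut off to `r' ≤ r`, a jointly measurable
function of `(x, r, r')`. -/
theorem aestronglyMeasurable_primitive (hq : AEStronglyMeasurable q (μ.prod ν)) :
    AEStronglyMeasurable (primitive ν q) (μ.prod ν) := by
  have h1 : AEStronglyMeasurable (fun z : (X × ℝ) × ℝ => q (z.1.1, z.2)) ((μ.prod ν).prod ν) :=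
    hq.comp_quasiMeasurePreserving
      (QuasiMeasurePreserving.prodMap (Measure.quasiMeasurePreserving_fst (μ := μ) (ν := ν))
        (Measure.QuasiMeasurePreserving.id ν))
  have hs : MeasurableSet {z : (X × ℝ) × ℝ | z.2 ≤ z.1.2} :=
    measurableSet_le measurable_snd (measurable_snd.comp measurable_fst)
  have h2 := (h1.indicator hs).integral_prod_right'
  refine h2.congr (.of_forall fun p => ?_)
  rw [primitive, ← integral_indicator measurableSet_Iic]
  rfl

/-- Cauchy–Schwarz in time. The bound does not depend on `r`, so it yields square integrability both
on slices and on the product. -/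
theorem enorm_primitive_sq_le {x : X} (hx : AEStronglyMeasurable (fun r => q (x, r)) ν) (r : ℝ) :
    ‖primitive ν q (x, r)‖ₑ ^ 2 ≤ ν univ * ∫⁻ r', ‖q (x, r')‖ₑ ^ 2 ∂ν := by
  have h1 : ‖primitive ν q (x, r)‖ₑ ≤ eLpNorm (fun r' => q (x, r')) 1 ν := by
    rw [eLpNorm_one_eq_lintegral_enorm]
    exact (enorm_integral_le_lintegral_enorm _).trans (setLIntegral_le_lintegral _ _)
  have h2 := h1.trans (eLpNorm_le_eLpNorm_mul_rpow_measure_univ (q := 2) (by norm_num) hx)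
  refine (pow_le_pow_left₀ zero_le h2 2).trans (le_of_eq ?_)
  rw [mul_pow, eLpNorm_two_sq, mul_comm, ← ENNReal.rpow_natCast, ← ENNReal.rpow_mul]
  norm_num

theorem memLp_primitive_slice (hq : MemLp q 2 (μ.prod ν)) (r : ℝ) :
    MemLp (fun x => primitive ν q (x, r)) 2 μ := by
  have hm : AEStronglyMeasurable (fun x => primitive ν q (x, r)) μ := by
    have h1 : AEStronglyMeasurable q (μ.prod (ν.restrict (Iic r))) :=
      hq.1.mono_ac (Measure.AbsolutelyContinuous.prod Measure.AbsolutelyContinuous.rfl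
        Measure.restrict_le_self.absolutelyContinuous)
    exact h1.integral_prod_right'
  refine ⟨hm, ?_⟩
  have h2 : ∫⁻ x, ‖primitive ν q (x, r)‖ₑ ^ 2 ∂μ ≤
      ν univ * ∫⁻ p, ‖q p‖ₑ ^ 2 ∂(μ.prod ν) := by
    rw [lintegral_prod _ (hq.1.enorm.pow_const 2), ← lintegral_const_mul' _ _ (by simp)]
    refine lintegral_mono_ae ?_
    filter_upwards [hq.1.prodMk_left] with x hx
    exact enorm_primitive_sq_le hx r
  refine (eLpNorm_two_le_of_lintegral_le h2).trans_lt
    ((ENNReal.rpow_lt_top_iff_of_pos (by norm_num)).2 (ENNReal.mul_lt_top (by simp) ?_))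
  rw [← eLpNorm_two_sq]
  exact ENNReal.pow_lt_top hq.2

theorem memLp_primitive (hq : MemLp q 2 (μ.prod ν)) : MemLp (primitive ν q) 2 (μ.prod ν) := by
  have hm := aestronglyMeasurable_primitive hq.1
  refine ⟨hm, ?_⟩
  have h2 : ∫⁻ p, ‖primitive ν q p‖ₑ ^ 2 ∂(μ.prod ν) ≤
      (ν univ * ∫⁻ p, ‖q p‖ₑ ^ 2 ∂(μ.prod ν)) * ν univ := by
    rw [lintegral_prod _ (hm.enorm.pow_const 2), lintegral_prod _ (hq.1.enorm.pow_const 2),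
      ← lintegral_const_mul' _ _ (by simp), ← lintegral_mul_const' _ _ (by simp)]
    refine lintegral_mono_ae ?_
    filter_upwards [hq.1.prodMk_left] with x hx
    calc _ ≤ ∫⁻ _, ν univ * ∫⁻ r', ‖q (x, r')‖ₑ ^ 2 ∂ν ∂ν :=
          lintegral_mono fun r => enorm_primitive_sq_le hx r
      _ = _ := by rw [lintegral_const]
  refine (eLpNorm_two_le_of_lintegral_le h2).trans_lt
    ((ENNReal.rpow_lt_top_iff_of_pos (by norm_num)).2
      (ENNReal.mul_lt_top (ENNReal.mul_lt_top (by simp) ?_) (by simp)))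
  rw [← eLpNorm_two_sq]
  exact ENNReal.pow_lt_top hq.2

theorem ae_memLp_slice (hq : MemLp q 2 (μ.prod ν)) : ∀ᵐ x ∂μ, MemLp (fun r => q (x, r)) 2 ν := by
  have h2 : ∀ᵐ x ∂μ, ∫⁻ r', ‖q (x, r')‖ₑ ^ 2 ∂ν < ⊤ := by
    refine ae_lt_top' (hq.1.enorm.pow_const 2).lintegral_prod_right' ?_
    rw [← lintegral_prod _ (hq.1.enorm.pow_const 2), ← eLpNorm_two_sq]
    exact (ENNReal.pow_lt_top hq.2).ne
  filter_upwards [hq.1.prodMk_left, h2] with x hx1 hx2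
  exact ⟨hx1, (eLpNorm_two_le_of_lintegral_le le_rfl).trans_lt
    ((ENNReal.rpow_lt_top_iff_of_pos (by norm_num)).2 hx2)⟩

/-- Fubini. With `g = ∇φ` it turns the time integral in the integrated equation into a pairing with
the primitive field. -/
theorem integral_inner_primitive (hq : MemLp q 2 (μ.prod ν)) {g : X → H} (hg : MemLp g 2 μ)
    (r : ℝ) : ∫ x, (inner ℝ (primitive ν q (x, r)) (g x) : ℝ) ∂μ =
      ∫ r' in Iic r, ∫ x, (inner ℝ (q (x, r')) (g x) : ℝ) ∂μ ∂ν := by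
  have := FiniteDimensional.complete ℝ H
  have hle : μ.prod (ν.restrict (Iic r)) ≤ μ.prod ν := Measure.prod_mono le_rfl
    Measure.restrict_le_self
  have hi : Integrable (fun p : X × ℝ => (inner ℝ (q p) (g p.1) : ℝ))
      (μ.prod (ν.restrict (Iic r))) :=
    (integrable_inner hq (hg.comp_fst ν)).mono_measure hle
  rw [← integral_integral_swap (f := fun x r' => (inner ℝ (q (x, r')) (g x) : ℝ)) hi]
  refine integral_congr_ae ?_
  filter_upwards [ae_memLp_slice hq] with x hx
  have hxi : Integrable (fun r' => q (x, r')) (ν.restrict (Iic r)) :=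
    (hx.integrable (by norm_num)).restrict
  rw [real_inner_comm, primitive, ← integral_inner hxi]
  exact integral_congr_ae (.of_forall fun r' => real_inner_comm _ _)

end Primitive

theorem toReal_eLpNorm_sq {X : Type*} [MeasurableSpace X] {μ : Measure X} {f : X → H}
    (hf : MemLp f 2 μ) : (eLpNorm f 2 μ).toReal ^ 2 = ∫ x, ‖f x‖ ^ 2 ∂μ := by
  rw [← Lp.norm_toLp f hf, ← real_inner_self_eq_norm_sq, inner_toLp]
  simp_rw [real_inner_self_eq_norm_sq]

/-- If the dissipation is nonnegative, then the energy does not increase. -/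
theorem toReal_eLpNorm_sub_primitive_le {X : Type*} [MeasurableSpace X] {μ : Measure X} [SFinite μ]
    {q : X × ℝ → H} {s t : ℝ} (hst : s ≤ t)
    (hq : MemLp q 2 (μ.prod (volume.restrict (Ioc s t)))) {D : X → H} (hD : MemLp D 2 μ)
    (hpos : ∀ᵐ r ∂(volume.restrict (Ioc s t)),
      0 ≤ ∫ x, (inner ℝ (D x - primitive (volume.restrict (Ioc s t)) q (x, r)) (q (x, r)) : ℝ) ∂μ) :
    (eLpNorm (fun x => D x - primitive (volume.restrict (Ioc s t)) q (x, t)) 2 μ).toReal ≤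
      (eLpNorm D 2 μ).toReal := by
  set ν := volume.restrict (Ioc s t) with hν
  have hDt : MemLp (fun x => D x - primitive ν q (x, t)) 2 μ := hD.sub (memLp_primitive_slice hq t)
  have hi : Integrable (fun p : X × ℝ => (inner ℝ (D p.1 - primitive ν q p) (q p) : ℝ))
      (μ.prod ν) := integrable_inner ((hD.comp_fst ν).sub (memLp_primitive hq)) hq
  -- The energy identity holds pointwise in `x`. Integrating over `x` and exchanging the integrals
  -- expresses the energy loss through the dissipation on time slices, where `hpos` applies.
  have h1 : ∀ᵐ x ∂μ, ‖D x - primitive ν q (x, t)‖ ^ 2 =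
      ‖D x‖ ^ 2 - 2 * ∫ r, (inner ℝ (D x - primitive ν q (x, r)) (q (x, r)) : ℝ) ∂ν := by
    filter_upwards [ae_memLp_slice hq] with x hx
    have hxi : IntervalIntegrable (fun r => q (x, r)) volume s t :=
      (intervalIntegrable_iff_integrableOn_Ioc_of_le hst).2 (hx.integrable (by norm_num))
    have := norm_sq_sub_integral_eq hxi (D x)
    rw [hν, primitive_eq_intervalIntegral (right_mem_Icc.2 hst), this,
      intervalIntegral.integral_of_le hst]
    congr 2
    refine setIntegral_congr_fun measurableSet_Ioc fun r hr => ?_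
    rw [primitive_eq_intervalIntegral (Ioc_subset_Icc_self hr)]
  have h2 : 0 ≤ ∫ x, ∫ r, (inner ℝ (D x - primitive ν q (x, r)) (q (x, r)) : ℝ) ∂ν ∂μ := by
    rw [integral_integral_swap hi]
    exact integral_nonneg_of_ae hpos
  have h3 : ∫ x, ‖D x - primitive ν q (x, t)‖ ^ 2 ∂μ ≤ ∫ x, ‖D x‖ ^ 2 ∂μ := by
    rw [integral_congr_ae h1, integral_sub (by simpa using hD.integrable_norm_pow (by norm_num))
      (hi.integral_prod_left.const_mul 2), integral_const_mul]
    linarith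
  rw [← toReal_eLpNorm_sq hDt, ← toReal_eLpNorm_sq hD] at h3
  exact (pow_le_pow_iff_left₀ ENNReal.toReal_nonneg ENNReal.toReal_nonneg two_ne_zero).1 h3

end DiffusionSystem

namespace DiffusionSystem

variable {n N : ℕ} {Ω : Set (Euc n)} {T : ℝ}

/-! ### The pairing on almost every time slice -/

/-- `f = -div D` in the sense of distributions. -/
def IsDiv (Ω : Set (Euc n)) (f : Euc n → Euc N) (D : Euc n → Mat n N) : Prop :=
  MemLp f 2 (volume.restrict Ω) ∧ MemLp D 2 (volume.restrict Ω) ∧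
    ∀ φ : Euc n → Euc N, IsTestFun Ω φ → ∫ x in Ω, (inner ℝ (f x) (φ x) : ℝ) =
      ∫ x in Ω, (inner ℝ (D x) (gradCLM n N (fderiv ℝ φ x)) : ℝ)

/-- Both sides are continuous for the convergence of a function and its gradient in `L²`, so the
identity passes from test functions to `H¹₀`. -/
theorem IsDiv.integral_inner_eq {f : Euc n → Euc N} {D : Euc n → Mat n N} (h : IsDiv Ω f D)
    {w : Euc n → Euc N} {G : Euc n → Euc n →L[ℝ] Euc N} (hw : IsH10 Ω w G) :
    ∫ x in Ω, (inner ℝ (f x) (w x) : ℝ) = ∫ x in Ω, (inner ℝ (D x) (gradCLM n N (G x)) : ℝ) := by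
  obtain ⟨hw1, hw2, φ, hφ, hl1, hl2⟩ := hw
  have h1 := tendsto_integral_inner_right h.1 hw1 (fun k => (hφ k).memLp 2) hl1
  have h2 := tendsto_integral_inner_right h.2.1 (memLp_gradCLM hw2)
    (fun k => memLp_gradCLM ((hφ k).memLp_fderiv 2)) (tendsto_eLpNorm_gradCLM hl2)
  exact tendsto_nhds_unique h1 (h2.congr fun k => (h.2.2 _ (hφ k)).symm)

theorem tendsto_eLpNorm_mat {X : Type*} [MeasurableSpace X] {μ : Measure X}
    {F : ℕ → X → Mat n N} (hm : ∀ k α, AEStronglyMeasurable (fun x => F k x α) μ)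
    (h : ∀ α, Tendsto (fun k => eLpNorm (fun x => F k x α) 2 μ) atTop (𝓝 0)) :
    Tendsto (fun k => eLpNorm (F k) 2 μ) atTop (𝓝 0) := by
  rw [tendsto_eLpNorm_two_iff]
  simp_rw [enorm_mat_sq]
  have h1 : ∀ k, ∫⁻ x, ∑ α, ‖F k x α‖ₑ ^ 2 ∂μ = ∑ α, ∫⁻ x, ‖F k x α‖ₑ ^ 2 ∂μ := fun k =>
    lintegral_finsetSum' _ fun α _ => (hm k α).enorm.pow_const 2
  simp_rw [h1]
  rw [← Finset.sum_const_zero (s := (Finset.univ : Finset (Fin n)))]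
  exact tendsto_finsetSum _ fun α _ => tendsto_eLpNorm_two_iff.1 (h α)

theorem tendsto_eLpNorm_clm_apply {X E F : Type*} [MeasurableSpace X] {μ : Measure X}
    [NormedAddCommGroup E] [NormedSpace ℝ E] [NormedAddCommGroup F] [NormedSpace ℝ F]
    {G : X → E →L[ℝ] F} {Gk : ℕ → X → E →L[ℝ] F} (e : E)
    (h : Tendsto (fun k => eLpNorm (fun x => G x - Gk k x) 2 μ) atTop (𝓝 0)) :
    Tendsto (fun k => eLpNorm (fun x => G x e - Gk k x e) 2 μ) atTop (𝓝 0) := by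
  have h1 : ∀ k, eLpNorm (fun x => G x e - Gk k x e) 2 μ ≤
      ENNReal.ofReal ‖e‖ * eLpNorm (fun x => G x - Gk k x) 2 μ := fun k =>
    eLpNorm_le_mul_eLpNorm_of_ae_le_mul (.of_forall fun x => by
      rw [← sub_apply, mul_comm]; exact (G x - Gk k x).le_opNorm e) _
  refine tendsto_of_tendsto_of_tendsto_of_le_of_le tendsto_const_nhds ?_ (fun _ => zero_le) h1
  have := ENNReal.Tendsto.const_mul (a := ENNReal.ofReal ‖e‖) h (Or.inr (by simp))
  simpa using this

/-- `f` is the limit in `H¹(Ω)` of the `C¹` functions `fk`, with gradient `Df`. -/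
structure H1Approx (Ω : Set (Euc n)) (f : Euc n → Euc N) (Df : Fin n → Euc n → Euc N)
    (fk : ℕ → Euc n → Euc N) : Prop where
  memLp : MemLp f 2 (volume.restrict Ω)
  memLp_grad : ∀ α, MemLp (Df α) 2 (volume.restrict Ω)
  contDiffOn : ∀ k, ContDiffOn ℝ 1 (fk k) Ω
  tendsto : Tendsto (fun k => eLpNorm (fun x => f x - fk k x) 2 (volume.restrict Ω)) atTop (𝓝 0)
  tendsto_grad : ∀ α, Tendsto (fun k => eLpNorm (fun x => Df α x - fderiv ℝ (fk k) x (basisVec α)) 2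
    (volume.restrict Ω)) atTop (𝓝 0)

theorem H1Approx.aestronglyMeasurable (hΩ : IsOpen Ω) {f : Euc n → Euc N}
    {Df : Fin n → Euc n → Euc N} {fk : ℕ → Euc n → Euc N} (h : H1Approx Ω f Df fk) (k : ℕ) :
    AEStronglyMeasurable (fk k) (volume.restrict Ω) :=
  (h.contDiffOn k).continuousOn.aestronglyMeasurable hΩ.measurableSet

theorem H1Approx.aestronglyMeasurable_fderiv (hΩ : IsOpen Ω) {f : Euc n → Euc N}
    {Df : Fin n → Euc n → Euc N} {fk : ℕ → Euc n → Euc N} (h : H1Approx Ω f Df fk) (k : ℕ)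
    (e : Euc n) : AEStronglyMeasurable (fun x => fderiv ℝ (fk k) x e) (volume.restrict Ω) :=
  (((h.contDiffOn k).continuousOn_fderiv_of_isOpen hΩ le_rfl).clm_apply
    continuousOn_const).aestronglyMeasurable hΩ.measurableSet

/-- The gradient of a difference that lies in `H¹₀` is the difference of the gradients. -/
theorem H1Approx.grad_sub_ae_eq (hΩ : IsOpen Ω) {f g : Euc n → Euc N}
    {Df Dg : Fin n → Euc n → Euc N} {fk gk : ℕ → Euc n → Euc N} (hf : H1Approx Ω f Df fk)
    (hg : H1Approx Ω g Dg gk) {G : Euc n → Euc n →L[ℝ] Euc N}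
    (hG : IsH10 Ω (fun x => g x - f x) G) (α : Fin n) :
    (fun x => G x (basisVec α)) =ᵐ[volume.restrict Ω] fun x => Dg α x - Df α x := by
  obtain ⟨h1, h2, ψ, hψ, hl1, hl2⟩ := hG
  have hGe : MemLp (fun x => G x (basisVec α)) 2 (volume.restrict Ω) :=
    (ContinuousLinearMap.apply ℝ (Euc N) (basisVec α)).comp_memLp' h2
  refine ae_eq_of_forall_isTestFun hΩ (MemLp.locallyIntegrableOn_of_restrict hGe)
    (MemLp.locallyIntegrableOn_of_restrict ((hg.memLp_grad α).sub (hf.memLp_grad α)))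
    fun χ hχ => ?_
  -- Both candidates for the gradient are weak derivatives of `g - f`: one through the approximation
  -- in `H¹₀`, the other through those of `g` and `f`.
  have e1 := hχ.integral_fderiv_smul_of_tendsto hΩ (e := basisVec α)
    (fun k => ((hψ k).1.of_le (by exact_mod_cast le_top)).contDiffOn) h1.1 hGe.1 hl1
    (tendsto_eLpNorm_clm_apply _ hl2)
  have e2 := hχ.integral_fderiv_smul_of_tendsto hΩ hf.contDiffOn hf.memLp.1 (hf.memLp_grad α).1
    hf.tendsto (hf.tendsto_grad α)
  have e3 := hχ.integral_fderiv_smul_of_tendsto hΩ hg.contDiffOn hg.memLp.1 (hg.memLp_grad α).1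
    hg.tendsto (hg.tendsto_grad α)
  have hi : ∀ {θ : Euc n → ℝ} {w : Euc n → Euc N}, IsTestFun Ω θ →
      MemLp w 2 (volume.restrict Ω) → Integrable (fun x => θ x • w x) (volume.restrict Ω) :=
    fun hθ hw => integrable_bilin (ContinuousLinearMap.lsmul ℝ ℝ) (hθ.memLp 2) hw
  have hχ' := hχ.fderiv_apply (basisVec α)
  simp only [smul_sub] at e1 ⊢
  rw [integral_sub (hi hχ' hg.memLp) (hi hχ' hf.memLp), e2, e3] at e1
  rw [integral_sub (hi hχ (hg.memLp_grad α)) (hi hχ (hf.memLp_grad α)), ← neg_inj, ← e1]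
  abel

/-- `P(g) - P(f)` can be paired with `f = -div D` if `g - f` has zero boundary values. -/
theorem IsDiv.integral_inner_comp_sub (hΩ : IsOpen Ω) {P : Euc N → Euc N} (hP : ContDiff ℝ 1 P)
    {C : ℝ} (hC : ∀ z, ‖fderiv ℝ P z‖ ≤ C) (hlip : ∀ a b, ‖P a - P b‖ ≤ C * ‖a - b‖)
    {f g : Euc n → Euc N} {Df Dg : Fin n → Euc n → Euc N} {fk gk : ℕ → Euc n → Euc N}
    (hf : H1Approx Ω f Df fk) (hg : H1Approx Ω g Dg gk) {G : Euc n → Euc n →L[ℝ] Euc N}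
    (hG : IsH10 Ω (fun x => g x - f x) G) {d : Euc n → Euc N} {D : Euc n → Mat n N}
    (hD : IsDiv Ω d D) :
    ∫ x in Ω, (inner ℝ (d x) (P (g x) - P (f x)) : ℝ) =
      ∫ x in Ω, (inner ℝ (D x) (tupleMat (fun α x => fderiv ℝ P (g x) (Dg α x) -
        fderiv ℝ P (f x) (Df α x)) x) : ℝ) := by
  have hA : Continuous (fderiv ℝ P) := hP.continuous_fderiv one_ne_zero
  have hPd := hP.differentiable one_ne_zero
  have hgrad := hf.grad_sub_ae_eq hΩ hg hG
  obtain ⟨h1, h2, ψ, hψ, hl1, hl2⟩ := hG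
  -- Zero boundary values survive composition with `P`: `v k` vanishes off the support of `ψ k`, so
  -- it is a compactly supported `C¹` function even though `fk` is controlled only inside `Ω`. It
  -- approximates `P(g) - P(f)`, since `fk + ψ k` tends to `f + (g - f) = g`.
  set v : ℕ → Euc n → Euc N := fun k x => P (fk k x + ψ k x) - P (fk k x) with hv
  have hv0 : ∀ k x, x ∉ tsupport (ψ k) → v k x = 0 := fun k x hx => by
    simp [hv, image_eq_zero_of_notMem_tsupport hx]
  have hvs : ∀ k, tsupport (v k) ⊆ tsupport (ψ k) := fun k =>
    closure_minimal (fun x hx => by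
      by_contra hx'
      exact hx (hv0 k x hx')) (isClosed_tsupport _)
  have hψ1 : ∀ k, ContDiff ℝ 1 (ψ k) := fun k => (hψ k).1.of_le (by exact_mod_cast le_top)
  have hvd : ∀ k, ContDiff ℝ 1 (v k) := by
    intro k
    rw [contDiff_iff_contDiffAt]
    intro x
    by_cases hx : x ∈ tsupport (ψ k)
    · have h3 : ContDiffAt ℝ 1 (fk k) x :=
        (hf.contDiffOn k).contDiffAt (hΩ.mem_nhds ((hψ k).2.2 hx))
      exact (hP.contDiffAt.comp x (h3.add (hψ1 k).contDiffAt)).sub (hP.contDiffAt.comp x h3)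
    · have : v k =ᶠ[𝓝 x] fun _ => 0 := by
        filter_upwards [(isClosed_tsupport (ψ k)).isOpen_compl.mem_nhds hx] with y hy
        exact hv0 k y hy
      exact contDiffAt_const.congr_of_eventuallyEq this
  have hvc : ∀ k, HasCompactSupport (v k) := fun k =>
    (hψ k).2.1.isCompact.of_isClosed_subset (isClosed_tsupport _) (hvs k)
  have hvH : ∀ k, IsH10 Ω (v k) (fderiv ℝ (v k)) := fun k =>
    isH10_of_contDiff hΩ (hvd k) (hvc k) ((hvs k).trans (hψ k).2.2)
  have hfkm := hf.aestronglyMeasurable hΩ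
  have hψm : ∀ k, AEStronglyMeasurable (ψ k) (volume.restrict Ω) := fun k =>
    (hψ1 k).continuous.aestronglyMeasurable
  have hψdm : ∀ k e, AEStronglyMeasurable (fun x => fderiv ℝ (ψ k) x e) (volume.restrict Ω) :=
    fun k e => (((hψ k).fderiv_apply e).1.continuous).aestronglyMeasurable
  have hsum : Tendsto (fun k => eLpNorm (fun x => g x - (fk k x + ψ k x)) 2 (volume.restrict Ω))
      atTop (𝓝 0) := by
    have := tendsto_eLpNorm_add (fun k => hf.memLp.1.sub (hfkm k)) (fun k => h1.1.sub (hψm k))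
      hf.tendsto hl1
    simpa using this
  have hcomp : ∀ {w : Euc n → Euc N} {wk : ℕ → Euc n → Euc N}, Tendsto (fun k =>
      eLpNorm (fun x => w x - wk k x) 2 (volume.restrict Ω)) atTop (𝓝 0) → Tendsto (fun k =>
      eLpNorm (fun x => P (w x) - P (wk k x)) 2 (volume.restrict Ω)) atTop (𝓝 0) := by
    intro w wk hw
    have h3 : ∀ k, eLpNorm (fun x => P (w x) - P (wk k x)) 2 (volume.restrict Ω) ≤
        ENNReal.ofReal C * eLpNorm (fun x => w x - wk k x) 2 (volume.restrict Ω) := fun k =>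
      eLpNorm_le_mul_eLpNorm_of_ae_le_mul (.of_forall fun x => hlip _ _) _
    refine tendsto_of_tendsto_of_tendsto_of_le_of_le tendsto_const_nhds ?_ (fun _ => zero_le) h3
    have := ENNReal.Tendsto.const_mul (a := ENNReal.ofReal C) hw (Or.inr (by simp))
    simpa using this
  have hPm : ∀ {w : Euc n → Euc N}, AEStronglyMeasurable w (volume.restrict Ω) →
      AEStronglyMeasurable (fun x => P (w x)) (volume.restrict Ω) := fun hw =>
    hP.continuous.comp_aestronglyMeasurable hw
  have hPsub : MemLp (fun x => P (g x) - P (f x)) 2 (volume.restrict Ω) :=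
    h1.of_le_mul ((hPm hg.memLp.1).sub (hPm hf.memLp.1)) (.of_forall fun x => hlip _ _)
  have hlimv : Tendsto (fun k => eLpNorm (fun x => (P (g x) - P (f x)) - v k x) 2
      (volume.restrict Ω)) atTop (𝓝 0) :=
    tendsto_eLpNorm_sub (fun k => (hPm hg.memLp.1).sub (hPm ((hfkm k).add (hψm k))))
      (fun k => (hPm hf.memLp.1).sub (hPm (hfkm k))) (hcomp hsum) (hcomp hf.tendsto)
  have happ : ∀ {w z : Euc n → Euc N}, AEStronglyMeasurable w (volume.restrict Ω) →
      AEStronglyMeasurable z (volume.restrict Ω) →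
      AEStronglyMeasurable (fun x => fderiv ℝ P (w x) (z x)) (volume.restrict Ω) := fun hw hz =>
    isBoundedBilinearMap_apply.continuous.comp_aestronglyMeasurable
      ((hA.comp_aestronglyMeasurable hw).prodMk hz)
  have happ2 : ∀ {w z : Euc n → Euc N}, AEStronglyMeasurable w (volume.restrict Ω) →
      MemLp z 2 (volume.restrict Ω) →
      MemLp (fun x => fderiv ℝ P (w x) (z x)) 2 (volume.restrict Ω) := fun hw hz =>
    hz.of_le_mul (happ hw hz.1)
      (.of_forall fun p => ContinuousLinearMap.le_of_opNorm_le _ (hC _) _)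
  have hQ : ∀ α, MemLp (fun x => fderiv ℝ P (g x) (Dg α x) - fderiv ℝ P (f x) (Df α x)) 2
      (volume.restrict Ω) := fun α =>
    (happ2 hg.memLp.1 (hg.memLp_grad α)).sub (happ2 hf.memLp.1 (hf.memLp_grad α))
  have hlimG : Tendsto (fun k => eLpNorm (fun x => tupleMat (fun α x => fderiv ℝ P (g x) (Dg α x) -
      fderiv ℝ P (f x) (Df α x)) x - gradCLM n N (fderiv ℝ (v k) x)) 2 (volume.restrict Ω))
      atTop (𝓝 0) := by
    refine tendsto_eLpNorm_mat (fun k α => ?_) fun α => ?_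
    · exact (hQ α).1.sub
        ((((hvd k).continuous_fderiv one_ne_zero).clm_apply continuous_const).aestronglyMeasurable)
    -- The limit `Df + G` of these gradients is `Dg` by `hgrad`.
    · have hsumd : Tendsto (fun k => eLpNorm (fun x => Dg α x - (fderiv ℝ (fk k) x (basisVec α) +
          fderiv ℝ (ψ k) x (basisVec α))) 2 (volume.restrict Ω)) atTop (𝓝 0) := by
        have hGe : AEStronglyMeasurable (fun x => G x (basisVec α)) (volume.restrict Ω) :=
          ((ContinuousLinearMap.apply ℝ (Euc N) (basisVec α)).comp_memLp' h2).1
        have := tendsto_eLpNorm_add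
          (fun k => (hf.memLp_grad α).1.sub (hf.aestronglyMeasurable_fderiv hΩ k (basisVec α)))
          (fun k => hGe.sub (hψdm k (basisVec α)))
          (hf.tendsto_grad α) (tendsto_eLpNorm_clm_apply (basisVec α) hl2)
        refine this.congr fun k => eLpNorm_congr_ae ?_
        filter_upwards [hgrad α] with x hx
        rw [hx]
        abel_nf
      have l1 := tendsto_eLpNorm_apply hA hC hg.memLp.1 (fun k => (hfkm k).add (hψm k))
        (hg.memLp_grad α) (fun k => (hf.aestronglyMeasurable_fderiv hΩ k (basisVec α)).add
          (hψdm k (basisVec α))) hsum hsumd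
      have l2 := tendsto_eLpNorm_apply hA hC hf.memLp.1 hfkm (hf.memLp_grad α)
        (fun k => hf.aestronglyMeasurable_fderiv hΩ k (basisVec α)) hf.tendsto (hf.tendsto_grad α)
      refine (tendsto_eLpNorm_sub (fun k => (happ hg.memLp.1 (hg.memLp_grad α).1).sub
        (happ ((hfkm k).add (hψm k)) ((hf.aestronglyMeasurable_fderiv hΩ k (basisVec α)).add
          (hψdm k (basisVec α))))) (fun k => (happ hf.memLp.1 (hf.memLp_grad α).1).sub
        (happ (hfkm k) (hf.aestronglyMeasurable_fderiv hΩ k (basisVec α)))) l1 l2).congr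
        fun k => eLpNorm_congr_ae ?_
      filter_upwards [ae_restrict_mem hΩ.measurableSet] with x hx
      have hfx : DifferentiableAt ℝ (fk k) x :=
        ((hf.contDiffOn k).differentiableOn one_ne_zero).differentiableAt (hΩ.mem_nhds hx)
      have hψx : DifferentiableAt ℝ (ψ k) x := (hψ1 k).differentiable one_ne_zero x
      have d1 : HasFDerivAt (v k) _ x :=
        ((hPd (fk k x + ψ k x)).hasFDerivAt.comp x (hfx.hasFDerivAt.add hψx.hasFDerivAt)).sub
          ((hPd (fk k x)).hasFDerivAt.comp x hfx.hasFDerivAt)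
      simp [d1.fderiv]
  have t1 := tendsto_integral_inner_right hD.1 hPsub (fun k => (hvH k).1) hlimv
  have t2 := tendsto_integral_inner_right hD.2.1 (memLp_tupleMat hQ)
    (fun k => memLp_gradCLM (hvH k).2.1) hlimG
  exact tendsto_nhds_unique t1 (t2.congr fun k => (hD.integral_inner_eq (hvH k)).symm)

end DiffusionSystem

namespace DiffusionSystem

variable {n N : ℕ} {Ω : Set (Euc n)} {T : ℝ}

/-! ### The norm of `H⁻¹(Ω)` -/

theorem lintegral_grad_eq (G : Euc n → Euc n →L[ℝ] Euc N) :
    ∫⁻ x in Ω, ∑ α, ‖G x (basisVec α)‖ₑ ^ 2 =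
      eLpNorm (fun x => gradCLM n N (G x)) 2 (volume.restrict Ω) ^ 2 := by
  rw [eLpNorm_two_sq]
  simp_rw [enorm_mat_sq, gradCLM_apply]

theorem IsTestFun.differentiable {φ : Euc n → Euc N} (h : IsTestFun Ω φ) :
    Differentiable ℝ φ :=
  h.1.differentiable (by simp)

theorem IsTestFun.memLp_grad {φ : Euc n → Euc N} (h : IsTestFun Ω φ) :
    MemLp (fun x => gradCLM n N (fderiv ℝ φ x)) 2 (volume.restrict Ω) :=
  memLp_gradCLM (h.memLp_fderiv 2)

/-- The gradient of the test functions, with values in `L²`. -/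
noncomputable def testGrad (n N : ℕ) (Ω : Set (Euc n)) :
    testSpace (Euc N) Ω →ₗ[ℝ] Lp (Mat n N) 2 (volume.restrict Ω) where
  toFun φ := MemLp.toLp _ (IsTestFun.memLp_grad φ.2)
  map_add' φ ψ := by
    rw [← MemLp.toLp_add]
    congr 1
    ext1 x
    change gradCLM n N (fderiv ℝ (φ.1 + ψ.1) x) = _
    rw [fderiv_add (IsTestFun.differentiable φ.2 x) (IsTestFun.differentiable ψ.2 x), map_add]
    rfl
  map_smul' c φ := by
    rw [RingHom.id_apply, ← MemLp.toLp_const_smul]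
    congr 1
    ext1 x
    change gradCLM n N (fderiv ℝ (c • φ.1) x) = _
    rw [fderiv_const_smul (IsTestFun.differentiable φ.2 x), map_smul]
    rfl

theorem norm_testGrad (φ : testSpace (Euc N) Ω) : ‖testGrad n N Ω φ‖ =
    (eLpNorm (fun x => gradCLM n N (fderiv ℝ φ.1 x)) 2 (volume.restrict Ω)).toReal :=
  Lp.norm_toLp _ (IsTestFun.memLp_grad φ.2)

theorem abs_integral_le_hNegOneNorm {f : Euc n → Euc N} (hK : hNegOneNorm Ω f ≠ ⊤)
    (φ : testSpace (Euc N) Ω) (hφ : ‖testGrad n N Ω φ‖ ≤ 1) :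
    |∫ x in Ω, (inner ℝ (f x) (φ.1 x) : ℝ)| ≤ (hNegOneNorm Ω f).toReal := by
  have h1 : ∫⁻ x in Ω, ∑ α, ‖fderiv ℝ φ.1 x (basisVec α)‖ₑ ^ 2 ≤ 1 := by
    rw [lintegral_grad_eq]
    rw [norm_testGrad] at hφ
    refine pow_le_one₀ zero_le ?_
    rw [← ENNReal.ofReal_toReal (IsTestFun.memLp_grad φ.2).2.ne, ← ENNReal.ofReal_one]
    exact ENNReal.ofReal_le_ofReal hφ
  have h2 : ‖embed Ω f φ.1‖ₑ ≤ hNegOneNorm Ω f :=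
    le_iSup₂_of_le φ.1 (fderiv ℝ φ.1) (le_iSup₂_of_le (IsTestFun.isH10 φ.2) h1 le_rfl)
  have h3 := ENNReal.toReal_mono hK h2
  rwa [toReal_enorm] at h3

/-- A function of finite norm in `H⁻¹(Ω)` is the divergence of a field of no larger norm. -/
theorem exists_isDiv {f : Euc n → Euc N} (hf : MemLp f 2 (volume.restrict Ω))
    (hK : hNegOneNorm Ω f ≠ ⊤) : ∃ D, IsDiv Ω f D ∧
      (eLpNorm D 2 (volume.restrict Ω)).toReal ≤ (hNegOneNorm Ω f).toReal := by
  set K := (hNegOneNorm Ω f).toReal with hKdef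
  have hK0 : 0 ≤ K := ENNReal.toReal_nonneg
  have hi : ∀ φ : testSpace (Euc N) Ω,
      Integrable (fun x => (inner ℝ (f x) (φ.1 x) : ℝ)) (volume.restrict Ω) := fun φ =>
    integrable_inner hf (IsTestFun.memLp φ.2 2)
  let L : testSpace (Euc N) Ω →ₗ[ℝ] ℝ :=
    { toFun := fun φ => ∫ x in Ω, (inner ℝ (f x) (φ.1 x) : ℝ)
      map_add' := fun φ ψ => by
        rw [← integral_add (hi φ) (hi ψ)]
        simp [inner_add_right]
      map_smul' := fun c φ => by
        rw [RingHom.id_apply, smul_eq_mul, ← integral_const_mul]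
        simp [inner_smul_right] }
  have hone : ∀ φ, ‖testGrad n N Ω φ‖ ≤ 1 → |L φ| ≤ K := abs_integral_le_hNegOneNorm hK
  have hL : ∀ φ, |L φ| ≤ K * ‖testGrad n N Ω φ‖ := by
    intro φ
    -- The gradient is only a seminorm here: for `n = 0` it vanishes identically. If it is zero at
    -- `φ`, multiples of `φ` stay admissible in the supremum, and the one with value `K + 1` in
    -- modulus contradicts the bound `K` unless `L φ = 0`.
    by_cases h0 : ‖testGrad n N Ω φ‖ = 0
    · rw [h0, mul_zero]
      by_contra! hpos
      have h1 := hone (((K + 1) / |L φ|) • φ) (by rw [map_smul, norm_smul, h0]; simp)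
      rw [map_smul, smul_eq_mul, abs_mul, abs_div, abs_abs, div_mul_cancel₀ _ hpos.ne'] at h1
      rw [abs_of_nonneg (by positivity)] at h1
      linarith
    · have h1 := hone (‖testGrad n N Ω φ‖⁻¹ • φ) (by
        rw [map_smul, norm_smul, norm_inv, norm_norm, inv_mul_cancel₀ h0])
      have hp : 0 < ‖testGrad n N Ω φ‖ := lt_of_le_of_ne (norm_nonneg _) (Ne.symm h0)
      rwa [map_smul, smul_eq_mul, abs_mul, abs_inv, abs_norm, inv_mul_le_iff₀ hp, mul_comm] at h1
  obtain ⟨g, hg1, hg2⟩ := exists_inner_eq_of_le (testGrad n N Ω) L hK0 hL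
  refine ⟨g, ⟨hf, Lp.memLp g, fun φ hφ => ?_⟩, by rwa [← Lp.norm_def]⟩
  have h1 := hg2 ⟨φ, hφ⟩
  have h2 : inner ℝ g (testGrad n N Ω ⟨φ, hφ⟩) =
      ∫ x in Ω, (inner ℝ (g x) (gradCLM n N (fderiv ℝ φ x)) : ℝ) := by
    rw [← inner_toLp (Lp.memLp g) hφ.memLp_grad, Lp.toLp_coeFn]
    rfl
  rw [← h2, ← h1]
  rfl

/-- Cauchy–Schwarz against an admissible gradient. No minimality of `D` is needed, so the field may
be evolved in time without being projected onto gradients. -/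
theorem IsDiv.hNegOneNorm_le {f : Euc n → Euc N} {D : Euc n → Mat n N} (h : IsDiv Ω f D) :
    hNegOneNorm Ω f ≤ eLpNorm D 2 (volume.restrict Ω) := by
  refine iSup₂_le fun φ G => iSup₂_le fun hG hle => ?_
  have hGm := memLp_gradCLM hG.2.1
  rw [lintegral_grad_eq] at hle
  have h1 : eLpNorm (fun x => gradCLM n N (G x)) 2 (volume.restrict Ω) ≤ 1 := by
    by_contra! hlt
    exact absurd hle (not_le.2 (one_lt_pow₀ hlt two_ne_zero))
  rw [embed, h.integral_inner_eq hG, Real.enorm_eq_ofReal_abs]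
  refine ENNReal.ofReal_le_of_le_toReal ((abs_integral_inner_le h.2.1 hGm).trans ?_)
  refine mul_le_of_le_one_right ENNReal.toReal_nonneg ?_
  simpa using ENNReal.toReal_mono ENNReal.one_ne_top h1

/-- A representing field of norm zero makes `f` orthogonal to all test functions, which are dense.
-/
theorem ae_eq_zero_of_hNegOneNorm_eq_zero (hΩ : IsOpen Ω) {f : Euc n → Euc N}
    (hf : MemLp f 2 (volume.restrict Ω)) (h : hNegOneNorm Ω f = 0) :
    f =ᵐ[volume.restrict Ω] 0 := by
  obtain ⟨D, hD, hle⟩ := exists_isDiv hf (by simp [h])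
  rw [h, ENNReal.toReal_zero] at hle
  have h0 : hf.toLp f = 0 := by
    refine (dense_range_testToLp (F := Euc N) (μ := volume) hΩ).eq_zero_of_inner_left ℝ ?_
    rintro _ ⟨φ, rfl⟩
    have h2 : MemLp φ.1 2 (volume.restrict Ω) := IsTestFun.memLp φ.2 2
    change inner ℝ (hf.toLp f) (h2.toLp φ.1) = 0
    rw [inner_toLp, hD.2.2 φ.1 φ.2, ← abs_eq_zero]
    refine le_antisymm ((abs_integral_inner_le hD.2.1 (IsTestFun.memLp_grad φ.2)).trans ?_)
      (abs_nonneg _)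
    exact mul_nonpos_of_nonpos_of_nonneg hle ENNReal.toReal_nonneg
  have h1 := hf.coeFn_toLp
  rw [h0] at h1
  exact h1.symm.trans (Lp.coeFn_zero _ _ _)

end DiffusionSystem

namespace DiffusionSystem

variable {n N : ℕ} {Ω : Set (Euc n)} {T : ℝ}

/-! ### Contraction in `H⁻¹(Ω)` -/

/-- `u` solves `u_t = Δ[P(u)]`; it is approximated by `ψ`, its gradient is `Du`, and that of `P(u)`
is `Dv`. -/
structure SolData (P : Euc N → Euc N) (Ω : Set (Euc n)) (T : ℝ) (u : Euc n × ℝ → Euc N)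
    (Du Dv : Fin n → Euc n × ℝ → Euc N) (ψ : ℕ → Euc n × ℝ → Euc N) : Prop where
  approx : VApprox Ω T u Du ψ
  memLp : ∀ α, MemLp (Dv α) 2 (volume.restrict (cyl Ω T))
  weakDeriv : ∀ α, HasWeakSpaceDeriv Ω T α (fun p => P (u p)) (Dv α)
  eqn : ∀ (w : Euc n × ℝ → Euc N) (W : Euc n × ℝ → (Euc n × ℝ) →L[ℝ] Euc N),
    IsH10 (cyl Ω T) w W → ∫ p in cyl Ω T, (- inner ℝ (u p) (W p (0, 1)) +
      ∑ α, inner ℝ (Dv α p) (W p (basisVec α, 0))) = 0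

theorem IsWeakSolution.exists_solData {Φ : Euc N → ℝ} {u : Euc n × ℝ → Euc N}
    (h : IsWeakSolution Φ Ω T u) : ∃ Du Dv ψ, SolData (gradient Φ) Ω T u Du Dv ψ := by
  obtain ⟨hV, Dv, h1, h2, h3⟩ := h
  obtain ⟨Du, ψ, hψ⟩ := hV.exists_vApprox
  exact ⟨Du, Dv, ψ, hψ, h1, h2, h3⟩

theorem VApprox.isTimeValue (hΩ : IsOpen Ω) {u : Euc n × ℝ → Euc N}
    {Du : Fin n → Euc n × ℝ → Euc N} {ψ : ℕ → Euc n × ℝ → Euc N} (h : VApprox Ω T u Du ψ) {t : ℝ}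
    (ht : t ∈ Ioo 0 T) : IsTimeValue Ω T u t fun x => u (x, t) :=
  ⟨h.memLp_slice hΩ ht, fun _ hψ => h.tendsto_integral_inner_slice hΩ ht hψ⟩

theorem ae_memLp_slice_right {X Y F : Type*} [MeasurableSpace X] [MeasurableSpace Y]
    {μ : Measure X} {ν : Measure Y} [SFinite μ] [SFinite ν] [NormedAddCommGroup F]
    {q : X × Y → F} (hq : MemLp q 2 (μ.prod ν)) : ∀ᵐ t ∂ν, MemLp (fun x => q (x, t)) 2 μ := by
  have h2 : ∀ᵐ t ∂ν, ∫⁻ x, ‖q (x, t)‖ₑ ^ 2 ∂μ < ⊤ := by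
    refine ae_lt_top' (hq.1.enorm.pow_const 2).lintegral_prod_left' ?_
    rw [← lintegral_prod_symm _ (hq.1.enorm.pow_const 2), ← eLpNorm_two_sq]
    exact (ENNReal.pow_lt_top hq.2).ne
  filter_upwards [aestronglyMeasurable_slice hq.1, h2] with t ht1 ht2
  exact ⟨ht1, (eLpNorm_two_le_of_lintegral_le le_rfl).trans_lt
    ((ENNReal.rpow_lt_top_iff_of_pos (by norm_num)).2 ht2)⟩

/-- The boundary condition is posed on slices, so the approximation must hold there. Gradients are
controlled only in space-time, whence the subsequence and the exceptional null set of times. -/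
theorem VApprox.ae_h1Approx (hΩ : IsOpen Ω) {u : Euc n × ℝ → Euc N}
    {Du : Fin n → Euc n × ℝ → Euc N} {ψ : ℕ → Euc n × ℝ → Euc N} (h : VApprox Ω T u Du ψ) :
    ∀ᵐ t ∂(volume.restrict (Ioo 0 T)), ∃ fk, H1Approx Ω (fun x => u (x, t))
      (fun α x => Du α (x, t)) fk := by
  obtain ⟨ns, hns, hae⟩ := h.exists_subseq hΩ
  have hm : ∀ᵐ t ∂(volume.restrict (Ioo 0 T)), ∀ α,
      MemLp (fun x => Du α (x, t)) 2 (volume.restrict Ω) := by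
    refine ae_all_iff.2 fun α => ae_memLp_slice_right ?_
    rw [← restrict_cyl]
    exact h.memLp_grad hΩ α
  filter_upwards [hae, hm, ae_restrict_mem measurableSet_Ioo] with t ht1 ht2 ht
  refine ⟨fun k x => ψ (ns k) (x, t), h.memLp_slice hΩ ht, ht2,
    fun k => contDiffOn_slice (h.contDiffOn _) ht,
    (h.tendsto_slice ht).comp hns.tendsto_atTop, fun α => (ht1 α).congr fun k => ?_⟩
  refine eLpNorm_congr_ae ?_
  filter_upwards [ae_restrict_mem hΩ.measurableSet] with x hx
  rw [fderiv_slice_apply (differentiableAt_of_mem_cyl hΩ (h.contDiffOn _) ⟨hx, ht⟩)]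

/-! ### Comparison of two solutions -/

section Two

variable {P : Euc N → Euc N} {u₀ u₁ : Euc n × ℝ → Euc N} {Du₀ Dv₀ Du₁ Dv₁ : Fin n → Euc n × ℝ → Euc N}
  {ψ₀ ψ₁ : ℕ → Euc n × ℝ → Euc N}

/-- The dissipation is nonnegative. -/
theorem ae_integral_inner_nonneg (hΩ : IsOpen Ω) (hP : ContDiff ℝ 1 P)
    {C : ℝ} (hC : ∀ z, ‖fderiv ℝ P z‖ ≤ C) (hlip : ∀ a b, ‖P a - P b‖ ≤ C * ‖a - b‖)
    (hmono : ∀ a b, 0 ≤ inner ℝ (a - b) (P a - P b)) (h₀ : SolData P Ω T u₀ Du₀ Dv₀ ψ₀)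
    (h₁ : SolData P Ω T u₁ Du₁ Dv₁ ψ₁) (hb : SameBoundaryValues Ω T u₀ u₁) :
    ∀ᵐ t ∂(volume.restrict (Ioo 0 T)), ∀ D, IsDiv Ω (fun x => u₀ (x, t) - u₁ (x, t)) D →
      0 ≤ ∫ x in Ω, (inner ℝ (D x) (tupleMat Dv₀ (x, t) - tupleMat Dv₁ (x, t)) : ℝ) := by
  have hb' := ae_mono (Measure.restrict_mono (Ioo_subset_Icc_self (a := (0 : ℝ)) (b := T)) le_rfl) hb
  have hchain : ∀ {u : Euc n × ℝ → Euc N} {Du Dv ψ}, SolData P Ω T u Du Dv ψ →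
      ∀ᵐ t ∂(volume.restrict (Ioo 0 T)), ∀ᵐ x ∂(volume.restrict Ω), ∀ α,
        Dv α (x, t) = fderiv ℝ P (u (x, t)) (Du α (x, t)) := by
    intro u Du Dv ψ h
    have h1 : ∀ᵐ p ∂(volume.restrict (cyl Ω T)), ∀ α, Dv α p = fderiv ℝ P (u p) (Du α p) :=
      ae_all_iff.2 fun α => h.approx.weakDeriv_comp hΩ hP hC hlip (h.weakDeriv α)
    rw [restrict_cyl] at h1
    exact ae_ae_slice h1
  -- The exceptional times are fixed before `D`; this is essential because the field inserted later
  -- depends on the time.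
  filter_upwards [hb', hchain h₀, hchain h₁, h₀.approx.ae_h1Approx hΩ, h₁.approx.ae_h1Approx hΩ]
    with t ⟨G, hG⟩ hc₀ hc₁ ⟨f₀, hf₀⟩ ⟨f₁, hf₁⟩ D hD
  have h1 := hD.integral_inner_comp_sub hΩ hP hC hlip hf₁ hf₀ hG
  have h2 : ∫ x in Ω, (inner ℝ (D x) (tupleMat Dv₀ (x, t) - tupleMat Dv₁ (x, t)) : ℝ) =
      ∫ x in Ω, (inner ℝ (u₀ (x, t) - u₁ (x, t)) (P (u₀ (x, t)) - P (u₁ (x, t))) : ℝ) := by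
    rw [h1]
    refine integral_congr_ae ?_
    filter_upwards [hc₀, hc₁] with x hx₀ hx₁
    congr 1
    ext1 α
    simp [hx₀ α, hx₁ α]
  rw [h2]
  exact integral_nonneg fun x => hmono _ _

/-- The evolution of a field whose divergence is the difference of two solutions. -/
theorem SolData.isDiv_sub (hΩ : IsOpen Ω) (hT : 0 < T) (h₀ : SolData P Ω T u₀ Du₀ Dv₀ ψ₀)
    (h₁ : SolData P Ω T u₁ Du₁ Dv₁ ψ₁) {s t r : ℝ} (hs : s ∈ Icc 0 T) (ht : t ∈ Icc 0 T)
    (hr : r ∈ Icc s t) {a₀ a₁ c₀ c₁ : Euc n → Euc N} (ha₀ : IsTimeValue Ω T u₀ s a₀)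
    (ha₁ : IsTimeValue Ω T u₁ s a₁) (hc₀ : IsTimeValue Ω T u₀ r c₀)
    (hc₁ : IsTimeValue Ω T u₁ r c₁)
    (hq : MemLp (fun p => tupleMat Dv₀ p - tupleMat Dv₁ p) 2
      ((volume.restrict Ω).prod (volume.restrict (Ioc s t))))
    {D : Euc n → Mat n N} (hD : IsDiv Ω (fun x => a₀ x - a₁ x) D) :
    IsDiv Ω (fun x => c₀ x - c₁ x) fun x => D x - primitive (volume.restrict (Ioc s t))
      (fun p => tupleMat Dv₀ p - tupleMat Dv₁ p) (x, r) := by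
  have hr' : r ∈ Icc 0 T := ⟨hs.1.trans hr.1, hr.2.trans ht.2⟩
  have hpr := memLp_primitive_slice hq r
  refine ⟨hc₀.1.sub hc₁.1, hD.2.1.sub hpr, fun φ hφ => ?_⟩
  have hφ2 : MemLp φ 2 (volume.restrict Ω) := hφ.memLp 2
  have e₀ := ha₀.integral_inner_sub hΩ hT h₀.approx h₀.memLp h₀.eqn hs hr' hc₀ hφ
  have e₁ := ha₁.integral_inner_sub hΩ hT h₁.approx h₁.memLp h₁.eqn hs hr' hc₁ hφ
  have e₂ := hD.2.2 φ hφ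
  have e₃ := integral_inner_primitive hq hφ.memLp_grad r
  simp only [inner_sub_left] at e₂ ⊢
  rw [integral_sub (integrable_inner ha₀.1 hφ2) (integrable_inner ha₁.1 hφ2)] at e₂
  rw [integral_sub (integrable_inner hc₀.1 hφ2) (integrable_inner hc₁.1 hφ2), e₀, e₁,
    integral_sub (integrable_inner hD.2.1 hφ.memLp_grad) (integrable_inner hpr hφ.memLp_grad),
    ← e₂, e₃]
  have hset : Iic r ∩ Ioc s t = Ioc s r := by
    ext y
    simp only [mem_inter_iff, mem_Iic, mem_Ioc]
    exact ⟨fun h => ⟨h.2.1, h.1⟩, fun h => ⟨h.2, h.1, h.2.trans hr.2⟩⟩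
  have hII : ∀ {Dv : Fin n → Euc n × ℝ → Euc N},
      (∀ α, MemLp (Dv α) 2 (volume.restrict (cyl Ω T))) →
      IntervalIntegrable (gradPair Ω (tupleMat Dv) φ) volume s r := fun hDv =>
    ((intervalIntegrable_iff_integrableOn_Ioo_of_le hT.le).2
      (integrableOn_gradPair (memLp_tupleMat hDv) hφ)).mono_set (by
        rw [uIcc_of_le hr.1, uIcc_of_le hT.le]; exact Icc_subset_Icc hs.1 hr'.2)
  have hle : (volume : Measure ℝ).restrict (Ioc s r) ≤ volume.restrict (Ioo 0 T) := by
    rw [Measure.restrict_congr_set (Ioo_ae_eq_Ioc (a := (0 : ℝ)) (b := T))]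
    exact Measure.restrict_mono (Ioc_subset_Ioc hs.1 hr'.2) le_rfl
  have e₄ : ∫ r' in Iic r, (∫ x in Ω, (inner ℝ (tupleMat Dv₀ (x, r') - tupleMat Dv₁ (x, r'))
      (gradCLM n N (fderiv ℝ φ x)) : ℝ)) ∂(volume.restrict (Ioc s t)) =
      (∫ r' in s..r, gradPair Ω (tupleMat Dv₀) φ r') -
        ∫ r' in s..r, gradPair Ω (tupleMat Dv₁) φ r' := by
    rw [← intervalIntegral.integral_sub (hII h₀.memLp) (hII h₁.memLp),
      Measure.restrict_restrict measurableSet_Iic, hset, intervalIntegral.integral_of_le hr.1]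
    refine integral_congr_ae ?_
    filter_upwards [ae_mono hle (integrable_inner_cyl (memLp_tupleMat h₀.memLp) hφ).prod_left_ae,
      ae_mono hle (integrable_inner_cyl (memLp_tupleMat h₁.memLp) hφ).prod_left_ae] with τ h1 h2
    rw [gradPair, gradPair, ← integral_sub h1 h2]
    simp only [inner_sub_left]
  rw [e₄]
  ring

/-- For a finite initial norm choose `D` at time `s` and subtract the primitive of the flux
difference. The norm at `t` is at most that of the evolved field, which is at most that of `D`,
which is at most the norm at `s`. -/
theorem hNegOneNorm_sub_le (hΩ : IsOpen Ω) (hT : 0 < T) (hP : ContDiff ℝ 1 P)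
    {C : ℝ} (hC : ∀ z, ‖fderiv ℝ P z‖ ≤ C) (hlip : ∀ a b, ‖P a - P b‖ ≤ C * ‖a - b‖)
    (hmono : ∀ a b, 0 ≤ inner ℝ (a - b) (P a - P b)) (h₀ : SolData P Ω T u₀ Du₀ Dv₀ ψ₀)
    (h₁ : SolData P Ω T u₁ Du₁ Dv₁ ψ₁) (hb : SameBoundaryValues Ω T u₀ u₁) {s t : ℝ}
    (hs : 0 ≤ s) (hst : s ≤ t) (ht : t ≤ T) {a₀ a₁ b₀ b₁ : Euc n → Euc N}
    (ha₀ : IsTimeValue Ω T u₀ s a₀) (ha₁ : IsTimeValue Ω T u₁ s a₁)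
    (hb₀ : IsTimeValue Ω T u₀ t b₀) (hb₁ : IsTimeValue Ω T u₁ t b₁) :
    hNegOneNorm Ω (fun x => b₀ x - b₁ x) ≤ hNegOneNorm Ω (fun x => a₀ x - a₁ x) := by
  by_cases hK : hNegOneNorm Ω (fun x => a₀ x - a₁ x) = ⊤
  · rw [hK]; exact le_top
  obtain ⟨D, hD, hDle⟩ := exists_isDiv (ha₀.1.sub ha₁.1) hK
  have hs' : s ∈ Icc 0 T := ⟨hs, hst.trans ht⟩
  have ht' : t ∈ Icc 0 T := ⟨hs.trans hst, ht⟩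
  -- `Ioc s t` may contain `T`, which is a null set.
  have hle : (volume : Measure ℝ).restrict (Ioc s t) ≤ volume.restrict (Ioo 0 T) := by
    rw [Measure.restrict_congr_set (Ioo_ae_eq_Ioc (a := (0 : ℝ)) (b := T))]
    exact Measure.restrict_mono (Ioc_subset_Ioc hs ht) le_rfl
  have hq : MemLp (fun p => tupleMat Dv₀ p - tupleMat Dv₁ p) 2
      ((volume.restrict Ω).prod (volume.restrict (Ioc s t))) := by
    have h2 : MemLp (fun p => tupleMat Dv₀ p - tupleMat Dv₁ p) 2 (volume.restrict (cyl Ω T)) :=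
      (memLp_tupleMat h₀.memLp).sub (memLp_tupleMat h₁.memLp)
    rw [restrict_cyl] at h2
    exact h2.mono_measure (Measure.prod_mono le_rfl hle)
  have hend := h₀.isDiv_sub hΩ hT h₁ hs' ht' (right_mem_Icc.2 hst) ha₀ ha₁ hb₀ hb₁ hq hD
  refine hend.hNegOneNorm_le.trans ?_
  rw [← ENNReal.toReal_le_toReal hend.2.1.2.ne hK]
  refine (toReal_eLpNorm_sub_primitive_le hst hq hD.2.1 ?_).trans hDle
  filter_upwards [ae_mono hle (ae_integral_inner_nonneg hΩ hP hC hlip hmono h₀ h₁ hb),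
    ae_mono hle (ae_restrict_mem measurableSet_Ioo), ae_restrict_mem measurableSet_Ioc]
    with r hr hr1 hr2
  exact hr _ (h₀.isDiv_sub hΩ hT h₁ hs' ht' (Ioc_subset_Icc_self hr2) ha₀ ha₁
    (h₀.approx.isTimeValue hΩ hr1) (h₁.approx.isTimeValue hΩ hr1) hq hD)

end Two

end DiffusionSystem

/-! ### The uniqueness theorem -/

theorem mainTheorem8 {n N : ℕ} (Ω : Set (DiffusionSystem.Euc n)) (hΩ : IsOpen Ω)
    (T : ℝ) (hT : 0 < T)
    (Φ : DiffusionSystem.Euc N → ℝ) (hΦ : ContDiff ℝ 2 Φ)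
    (lam Lam : ℝ) (hlam : 0 < lam)
    (hconv : ∀ z ξ : DiffusionSystem.Euc N,
      lam * ‖ξ‖ ^ 2 ≤ fderiv ℝ (fderiv ℝ Φ) z ξ ξ ∧
        fderiv ℝ (fderiv ℝ Φ) z ξ ξ ≤ Lam * ‖ξ‖ ^ 2)
    (u₀ u₁ : DiffusionSystem.Euc n × ℝ → DiffusionSystem.Euc N)
    (hu₀ : DiffusionSystem.IsWeakSolution Φ Ω T u₀)
    (hu₁ : DiffusionSystem.IsWeakSolution Φ Ω T u₁)
    (hbdry : DiffusionSystem.SameBoundaryValues Ω T u₀ u₁) :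
    -- the solutions have values at every time of `[0, T]`, which are the slices for `0 < t < T`
    (∀ u ∈ ({u₀, u₁} : Set (DiffusionSystem.Euc n × ℝ → DiffusionSystem.Euc N)),
      (∀ t ∈ Ioo (0 : ℝ) T, DiffusionSystem.IsTimeValue Ω T u t (fun x => u (x, t))) ∧
      (∃ g, DiffusionSystem.IsTimeValue Ω T u 0 g) ∧
      (∃ g, DiffusionSystem.IsTimeValue Ω T u T g)) ∧
    -- the estimate in `H^{-1}(Ω)` for `0 ≤ t₀ ≤ t₁ ≤ T`
    (∀ t₀ t₁ : ℝ, 0 ≤ t₀ → t₀ ≤ t₁ → t₁ ≤ T →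
      ∀ a₀ a₁ b₀ b₁ : DiffusionSystem.Euc n → DiffusionSystem.Euc N,
        DiffusionSystem.IsTimeValue Ω T u₀ t₀ a₀ → DiffusionSystem.IsTimeValue Ω T u₁ t₀ a₁ →
        DiffusionSystem.IsTimeValue Ω T u₀ t₁ b₀ → DiffusionSystem.IsTimeValue Ω T u₁ t₁ b₁ →
        DiffusionSystem.hNegOneNorm Ω (fun x => b₀ x - b₁ x) ≤
          ENNReal.ofReal (Real.exp (lam * (t₁ - t₀))) *
            DiffusionSystem.hNegOneNorm Ω (fun x => a₀ x - a₁ x)) ∧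
    -- uniqueness
    (∀ g : DiffusionSystem.Euc n → DiffusionSystem.Euc N,
      DiffusionSystem.IsTimeValue Ω T u₀ 0 g → DiffusionSystem.IsTimeValue Ω T u₁ 0 g →
      ∀ t ∈ Ioo (0 : ℝ) T,
        (fun x => u₀ (x, t)) =ᵐ[volume.restrict Ω] (fun x => u₁ (x, t))) := by
  have hC := DiffusionSystem.norm_fderiv_gradient_le hΦ fun z ξ =>
    ⟨(mul_nonneg hlam.le (sq_nonneg _)).trans (hconv z ξ).1, (hconv z ξ).2⟩
  have hlip := DiffusionSystem.norm_gradient_sub_le hΦ hC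
  have hmono := DiffusionSystem.inner_gradient_sub_nonneg hΦ fun z ξ =>
    (mul_nonneg hlam.le (sq_nonneg _)).trans (hconv z ξ).1
  obtain ⟨Du₀, Dv₀, ψ₀, h₀⟩ := hu₀.exists_solData
  obtain ⟨Du₁, Dv₁, ψ₁, h₁⟩ := hu₁.exists_solData
  have hcontr : ∀ t₀ t₁ : ℝ, 0 ≤ t₀ → t₀ ≤ t₁ → t₁ ≤ T →
      ∀ a₀ a₁ b₀ b₁ : DiffusionSystem.Euc n → DiffusionSystem.Euc N,
        DiffusionSystem.IsTimeValue Ω T u₀ t₀ a₀ → DiffusionSystem.IsTimeValue Ω T u₁ t₀ a₁ →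
        DiffusionSystem.IsTimeValue Ω T u₀ t₁ b₀ → DiffusionSystem.IsTimeValue Ω T u₁ t₁ b₁ →
        DiffusionSystem.hNegOneNorm Ω (fun x => b₀ x - b₁ x) ≤
          DiffusionSystem.hNegOneNorm Ω (fun x => a₀ x - a₁ x) :=
    fun t₀ t₁ hs hst ht a₀ a₁ b₀ b₁ ha₀ ha₁ hb₀ hb₁ =>
      DiffusionSystem.hNegOneNorm_sub_le hΩ hT (DiffusionSystem.contDiff_gradient hΦ) hC hlip hmono
        h₀ h₁ hbdry hs hst ht ha₀ ha₁ hb₀ hb₁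
  refine ⟨?_, ?_, ?_⟩
  · rintro u (rfl | rfl)
    · exact ⟨fun t ht => h₀.approx.isTimeValue hΩ ht,
        DiffusionSystem.exists_isTimeValue hΩ hT h₀.approx h₀.memLp h₀.eqn (left_mem_Icc.2 hT.le),
        DiffusionSystem.exists_isTimeValue hΩ hT h₀.approx h₀.memLp h₀.eqn (right_mem_Icc.2 hT.le)⟩
    · exact ⟨fun t ht => h₁.approx.isTimeValue hΩ ht,
        DiffusionSystem.exists_isTimeValue hΩ hT h₁.approx h₁.memLp h₁.eqn (left_mem_Icc.2 hT.le),
        DiffusionSystem.exists_isTimeValue hΩ hT h₁.approx h₁.memLp h₁.eqn (right_mem_Icc.2 hT.le)⟩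
  · intro t₀ t₁ hs hst ht a₀ a₁ b₀ b₁ ha₀ ha₁ hb₀ hb₁
    -- The contraction already has constant 1, and the exponential factor is at least 1 because
    -- `lam` is positive and `t₀ ≤ t₁`.
    refine (hcontr t₀ t₁ hs hst ht a₀ a₁ b₀ b₁ ha₀ ha₁ hb₀ hb₁).trans
      (le_mul_of_one_le_left zero_le ?_)
    rw [ENNReal.one_le_ofReal]
    exact Real.one_le_exp (mul_nonneg hlam.le (sub_nonneg.2 hst))
  · intro g hg₀ hg₁ t ht
    have ht₀ := h₀.approx.isTimeValue hΩ ht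
    have ht₁ := h₁.approx.isTimeValue hΩ ht
    have h := hcontr 0 t le_rfl ht.1.le ht.2.le g g _ _ hg₀ hg₁ ht₀ ht₁
    have h0 : DiffusionSystem.hNegOneNorm Ω (fun x => g x - g x) = 0 := by
      simp [DiffusionSystem.hNegOneNorm, DiffusionSystem.embed]
    rw [h0] at h
    filter_upwards [DiffusionSystem.ae_eq_zero_of_hNegOneNorm_eq_zero hΩ (ht₀.1.sub ht₁.1)
      (le_antisymm h zero_le)] with x hx
    exact sub_eq_zero.1 hx
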